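/- Let $A$ be the free abelian group on $a,b,c$, let $B=\langle A,t\mid a^t=ab,\ b^t=bc,\ c^t=c\rangle$ (where $x^t=t^{-1}xt$) be the corresponding HNN-extension, let $F=\langle f\rangle$ be infinite cyclic, and let $K=B\times F$. A rational closure of a group $G$ is a torsion-free nilpotent group $\overline G$ containing $G$, in which every element has a unique $n$-th root for every integer $n\ge 1$, and every element of which has a positive power in $G$. A group is called directly indecomposable if it is nontrivial and is not the internal direct product of two nontrivial subgroups. The group $K$ has a rational closure. Let $\overline K$ be any rational closure of $K$. For an integer $p>1$ let $G_p=\langle K,s\rangle\le\overline K$ be Baumslag's group, where $s$ is the unique $p$-th root of $bf$ in $\overline K$. Then: 1. For every $p>1$ the group $G_p$ is finitely generated, torsion-free, nilpotent and directly indecomposable. 2. Let $p,q>1$ be coprime integers and let $D=G_p\times G_q$. Write $f\in G_p$ and $\varphi\in G_q$ for the respective copies of the generator of $F$. Then $T=\langle f\varphi^{-1}\rangle$ is infinite cyclic, hence directly indecomposable, and it is a direct factor of $D$. For every direct complement $S$ of $T$ in $D$, $D\cong\mathbb Z\times S$, the group $S$ is directly indecomposable, and neither $T\cong\mathbb Z$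 nor $S$ is isomorphic to $G_p$ or to $G_q$. 3. Consequently (Baumslag), direct decompositions of finitely generated torsion-free nilpotent groups into directly indecomposable factors are not unique, even up to isomorphism: there is a finitely generated torsion-free nilpotent group $D$ with $D\cong G_1\times G_2\cong H_1\times H_2$, where $G_1,G_2,H_1,H_2$ are directly indecomposable and no $G_i$ is isomorphic to any $H_j$. -/

import Mathlib

namespace BaumslagExample

/-- A group is torsion-free if no non-identity element has finite order. -/
def TorsionFree (G : Type*) [Group G] : Prop :=
  ∀ g : G, g ≠ 1 → ¬ IsOfFinOrder g

/-- A group is directly indecomposable if it is nontrivial and is not the internal direct product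
of two nontrivial subgroups. -/
def DirectlyIndecomposable (G : Type*) [Group G] : Prop :=
  Nontrivial G ∧ ∀ H L : Subgroup G, H.Normal → L.Normal → IsCompl H L → H = ⊥ ∨ L = ⊥

/-- `ι : G →* R` exhibits `R` as the rational closure (Malcev completion) of `G`. -/
structure IsRationalClosure {G R : Type*} [Group G] [Group R] (ι : G →* R) : Prop where
  nilpotent : Group.IsNilpotent R
  torsionFree : TorsionFree R
  injective : Function.Injective ι
  existsUnique_root : ∀ (h : R) (n : ℕ), 0 < n → ∃! k : R, k ^ n = h
  exists_pow_mem : ∀ h : R, ∃ n : ℕ, 0 < n ∧ h ^ n ∈ ι.range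

/-- The free abelian group of rank 3; `(x, y, z)` stands for `a ^ x * b ^ y * c ^ z`. -/
abbrev A : Type := Multiplicative (ℤ × ℤ × ℤ)

/-- The free generator `a` of `A`. -/
def A.a : A := Multiplicative.ofAdd (1, 0, 0)

/-- The free generator `b` of `A`. -/
def A.b : A := Multiplicative.ofAdd (0, 1, 0)

/-- The free generator `c` of `A`. -/
def A.c : A := Multiplicative.ofAdd (0, 0, 1)

/-- The automorphism `a ↦ a * b`, `b ↦ b * c`, `c ↦ c` of `A`. -/
def A.theta : A ≃* A := AddEquiv.toMultiplicative
  { toFun := fun v => (v.1, v.1 + v.2.1, v.2.1 + v.2.2)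
    invFun := fun v => (v.1, v.2.1 - v.1, v.2.2 - v.2.1 + v.1)
    left_inv := fun v => by refine Prod.ext ?_ (Prod.ext ?_ ?_) <;> dsimp only <;> ring
    right_inv := fun v => by refine Prod.ext ?_ (Prod.ext ?_ ?_) <;> dsimp only <;> ring
    map_add' := fun v w => by ext <;> simp <;> ring }

/-- The HNN-extension `B = ⟨A, t ∣ a ^ t = a * b, b ^ t = b * c, c ^ t = c⟩`, where
`x ^ t = t⁻¹ * x * t`. The inverse of `A.theta` appears because Mathlib's stable letter satisfies
`t * x * t⁻¹ = φ x`. -/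
abbrev B : Type :=
  HNNExtension A ⊤ ⊤
    ((Subgroup.topEquiv.trans A.theta.symm).trans (Subgroup.topEquiv (G := A)).symm)

/-- The generator `a` of `B`. -/
def B.a : B := HNNExtension.of A.a

/-- The generator `b` of `B`. -/
def B.b : B := HNNExtension.of A.b

/-- The generator `c` of `B`. -/
def B.c : B := HNNExtension.of A.c

/-- The stable letter `t` of `B`. -/
def B.t : B := HNNExtension.t

theorem B.conj_of (x : A) : B.t⁻¹ * HNNExtension.of x * B.t = HNNExtension.of (A.theta x) := by
  have h := HNNExtension.t_mul_of (G := A) (A := ⊤) (B := ⊤)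
    (φ := (Subgroup.topEquiv.trans A.theta.symm).trans (Subgroup.topEquiv (G := A)).symm)
    ⟨A.theta x, trivial⟩
  have h' : B.t * (HNNExtension.of (A.theta x) : B) = HNNExtension.of x * B.t := by
    simpa [B.t] using h
  rw [mul_assoc, ← h', inv_mul_cancel_left]

theorem B.conj_a : B.t⁻¹ * B.a * B.t = B.a * B.b := by
  rw [B.a, B.conj_of, B.b, ← map_mul]; rfl

theorem B.conj_b : B.t⁻¹ * B.b * B.t = B.b * B.c := by
  rw [B.b, B.conj_of, B.c, ← map_mul]; rfl

theorem B.conj_c : B.t⁻¹ * B.c * B.t = B.c := by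
  rw [B.c, B.conj_of]; rfl

/-- `K = B × F`, where `F` is the infinite cyclic group. -/
abbrev K : Type := B × Multiplicative ℤ

/-- The element `b` of `K`. -/
def K.b : K := (B.b, 1)

/-- The generator `f` of the factor `F` of `K`. -/
def K.f : K := (1, Multiplicative.ofAdd 1)

/-- Baumslag's group `G_p = ⟨K, s⟩` inside the rational closure `R` of `K`, where `s` is the
`p`-th root of `b * f` in `R` (unique when `ι` is a rational closure and `0 < p`). -/
def baumslagGroup {R : Type*} [Group R] (ι : K →* R) (p : ℕ) : Subgroup R :=
  Subgroup.closure (Set.range ι ∪ {s : R | s ^ p = ι (K.b * K.f)})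

/-- The element `f` of `G_p`. -/
def baumslagGroup.f {R : Type*} [Group R] (ι : K →* R) (p : ℕ) : baumslagGroup ι p :=
  ⟨ι K.f, Subgroup.subset_closure (Or.inl ⟨K.f, rfl⟩)⟩

end BaumslagExample

/-! All computations take place in the group of tuples t^k a^x s^y f^z w^u, where f and w are
central, a and s commute, s^t = sw and a^t = a s^p f⁻¹. Integer tuples with p = 1 form K, rational
tuples with p = 1 form a rational closure of K, and uniqueness of roots identifies G_p, inside any
rational closure, with the integer tuples for p (`IsRationalClosure.exists_mulEquiv`).

Two facts carry the argument. First, elements with k = 0 commute and an element with k ≠ 0 has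
abelian centralizer, so two noncommuting pairs never centralize each other (`commute_or_commute`);
hence in a decomposition of G_p one factor is abelian, so central. Second, a homomorphism α with
commuting values kills w and sends f to α(s)^p (`Relations.map_w_and_map_f`). The center is ⟨f, w⟩,
so projecting to a central factor gives α(s) = α(s)^(pm); as p > 1 and there is no torsion, α is
trivial.

In G_p × G_q, Bézout coefficients combine the characters s ↦ 1, f ↦ p and s ↦ 1, φ ↦ q into a
retraction onto T. If a complement S split nontrivially, the two projections would each be central
in one coordinate, opposite ones; adding up the exponents of f and φ then gives 1 = 0
(`false_of_projections`). Finally S ≅ D/T still contains two noncommuting pairs centralizing each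
other, which G_p and G_q do not. -/

namespace BaumslagExample

/-! ### Binomial coefficients `choose r 2` -/

section Choose

variable {R : Type*} [CommRing R] [BinomialRing R]

theorem two_mul_choose_two (r : R) : 2 * Ring.choose r 2 = r * (r - 1) := by
  have h := Ring.descPochhammer_eq_factorial_smul_choose r 2
  simp only [descPochhammer_succ_right, descPochhammer_zero] at h
  simp [Polynomial.smeval_mul, Polynomial.smeval_sub, Polynomial.smeval_X,
    Polynomial.smeval_one, Nat.factorial] at h
  rw [← h]

theorem mul_two_cancel {r s : R} (h : 2 * r = 2 * s) : r = s := by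
  have : IsAddTorsionFree R := BinomialRing.toIsAddTorsionFree
  exact nsmul_right_injective (two_ne_zero : (2 : ℕ) ≠ 0) (by simpa [two_mul, two_nsmul] using h)

theorem choose_two_add (r s : R) :
    Ring.choose (r + s) 2 = Ring.choose r 2 + Ring.choose s 2 + r * s := by
  apply mul_two_cancel
  linear_combination two_mul_choose_two (r + s) - two_mul_choose_two r - two_mul_choose_two s

@[simp] theorem choose_two_zero : Ring.choose (0 : R) 2 = 0 :=
  mul_two_cancel (by rw [two_mul_choose_two]; ring)

@[simp] theorem choose_two_one : Ring.choose (1 : R) 2 = 0 :=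
  mul_two_cancel (by rw [two_mul_choose_two]; ring)

theorem choose_two_neg (r : R) : Ring.choose (-r) 2 = Ring.choose r 2 + r := by
  apply mul_two_cancel
  linear_combination two_mul_choose_two (-r) - two_mul_choose_two r

end Choose

/-- Coordinates for Baumslag's group with exponents in `R`: the tuple `(k, x, y, z, u)` stands for
`t ^ k * a ^ x * s ^ y * f ^ z * w ^ u`, where `w` is the commutator of `s` and `t`. -/
@[ext] structure Model (R : Type*) (p : ℕ) where
  /-- exponent of `t` -/
  k : R
  /-- exponent of `a` -/
  x : R
  /-- exponent of `s` -/
  y : R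
  /-- exponent of `f` -/
  z : R
  /-- exponent of `w` -/
  u : R

/-! ### The coordinate group and its commutation -/

namespace Model

variable {R : Type*} [CommRing R] [BinomialRing R] {p : ℕ}

section

variable {R : Type*} [CommRing R] {p : ℕ}

instance : One (Model R p) := ⟨⟨0, 0, 0, 0, 0⟩⟩

@[simp] theorem one_k : (1 : Model R p).k = 0 := rfl
@[simp] theorem one_x : (1 : Model R p).x = 0 := rfl
@[simp] theorem one_y : (1 : Model R p).y = 0 := rfl
@[simp] theorem one_z : (1 : Model R p).z = 0 := rfl
@[simp] theorem one_u : (1 : Model R p).u = 0 := rfl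

end

/-- The correction terms come from moving t^l to the left: s^y t^l = t^l s^y w^(ly) and a^x t^l =
t^l a^x s^(plx) f^(-lx) w^(p·C(l,2)·x). -/
instance : Mul (Model R p) :=
  ⟨fun g h => ⟨g.k + h.k, g.x + h.x, g.y + p * h.k * g.x + h.y, g.z - h.k * g.x + h.z,
    g.u + h.k * g.y + p * Ring.choose h.k 2 * g.x + h.u⟩⟩

instance : One (Model R p) := ⟨⟨0, 0, 0, 0, 0⟩⟩

instance : Inv (Model R p) :=
  ⟨fun g => ⟨-g.k, -g.x, -g.y + p * g.k * g.x, -g.z - g.k * g.x,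
    -g.u + g.k * g.y - p * (Ring.choose g.k 2 + g.k) * g.x⟩⟩

variable (g h : Model R p)

@[simp] theorem mul_k : (g * h).k = g.k + h.k := rfl
@[simp] theorem mul_x : (g * h).x = g.x + h.x := rfl
@[simp] theorem mul_y : (g * h).y = g.y + p * h.k * g.x + h.y := rfl
@[simp] theorem mul_z : (g * h).z = g.z - h.k * g.x + h.z := rfl
@[simp] theorem mul_u :
    (g * h).u = g.u + h.k * g.y + p * Ring.choose h.k 2 * g.x + h.u := rfl
@[simp] theorem inv_k : (g⁻¹).k = -g.k := rfl
@[simp] theorem inv_x : (g⁻¹).x = -g.x := rfl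
@[simp] theorem inv_y : (g⁻¹).y = -g.y + p * g.k * g.x := rfl
@[simp] theorem inv_z : (g⁻¹).z = -g.z - g.k * g.x := rfl
@[simp] theorem inv_u :
    (g⁻¹).u = -g.u + g.k * g.y - p * (Ring.choose g.k 2 + g.k) * g.x := rfl

instance : Group (Model R p) :=
  Group.ofLeftAxioms
    (fun g h l => by ext <;> simp [choose_two_add] <;> ring)
    (fun g => by ext <;> simp)
    (fun g => by
      ext <;> simp
      · linear_combination -(p : R) * g.x * two_mul_choose_two g.k)

variable {g h}

/-- The two conditions are the `z` and `u` coordinates; the discrepancy in `y` is a multiple of the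
one in `z`. -/
theorem commute_iff : Commute g h ↔ h.k * g.x = g.k * h.x ∧
    h.k * g.y + p * Ring.choose h.k 2 * g.x = g.k * h.y + p * Ring.choose g.k 2 * h.x := by
  constructor
  · intro H
    have hz := congrArg z H.eq
    have hu := congrArg u H.eq
    simp only [mul_z, mul_u] at hz hu
    exact ⟨by linear_combination -hz, by linear_combination hu⟩
  · rintro ⟨h1, h2⟩
    refine Model.ext ?_ ?_ ?_ ?_ ?_
    · simp [add_comm]
    · simp [add_comm]
    · simp only [mul_y]; linear_combination (p : R) * h1
    · simp only [mul_z]; linear_combination -h1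
    · simp only [mul_u]; linear_combination h2

/-- Eliminating the coordinates of `g` from the two pairs of equations leaves those for `h` and `l`,
multiplied by `g.k`. -/
theorem commute_of_commute [IsDomain R] {l : Model R p} (hk : g.k ≠ 0) (h1 : Commute g h)
    (h2 : Commute g l) : Commute h l := by
  rw [commute_iff] at *
  obtain ⟨a1, b1⟩ := h1
  obtain ⟨a2, b2⟩ := h2
  have e : l.k * h.x = h.k * l.x := by
    apply mul_left_cancel₀ hk
    linear_combination h.k * a2 - l.k * a1
  refine ⟨e, ?_⟩
  apply mul_left_cancel₀ hk
  linear_combination h.k * b2 - l.k * b1 - p * Ring.choose l.k 2 * a1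
    + p * Ring.choose h.k 2 * a2 - p * Ring.choose g.k 2 * e

/-- Two commuting pairs of noncommuting elements do not exist. -/
theorem commute_or_commute [IsDomain R] {g h g' h' : Model R p} (h1 : Commute g g')
    (h2 : Commute g h') (h3 : Commute h g') (h4 : Commute h h') :
    Commute g h ∨ Commute g' h' := by
  by_cases hg : g.k = 0
  · by_cases hh : h.k = 0
    · left
      rw [commute_iff]
      simp [hg, hh]
    · exact .inr (commute_of_commute hh h3 h4)
  · exact .inr (commute_of_commute hg h1 h2)

variable (R p)

/-- The generator `t`. -/
def t : Model R p := ⟨1, 0, 0, 0, 0⟩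
/-- The generator `a`. -/
def a : Model R p := ⟨0, 1, 0, 0, 0⟩
/-- The generator `s`. -/
def s : Model R p := ⟨0, 0, 1, 0, 0⟩
/-- The generator `f`. -/
def f : Model R p := ⟨0, 0, 0, 1, 0⟩
/-- The generator `w`. -/
def w : Model R p := ⟨0, 0, 0, 0, 1⟩

end Model

/-- The relations between the generators of Baumslag's group. -/
structure Relations {G : Type*} [Group G] (p : ℕ) (a s f w t : G) : Prop where
  as : Commute a s
  af : Commute a f
  aw : Commute a w
  sf : Commute s f
  sw : Commute s w
  fw : Commute f w
  tf : Commute t f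
  tw : Commute t w
  st : s * t = t * (s * w)
  at_ : a * t = t * (a * (s ^ p * f⁻¹))

namespace Model

theorem relations (R : Type*) [CommRing R] [BinomialRing R] (p : ℕ) :
    Relations p (a R p) (s R p) (f R p) (w R p) (t R p) := by
  have hs : ∀ n : ℕ, s R p ^ n = ⟨0, 0, n, 0, 0⟩ := by
    intro n
    induction n with
    | zero => ext <;> simp
    | succ n ih => rw [pow_succ, ih]; ext <;> simp [s]
  constructor
  all_goals first | (rw [commute_iff]; simp [a, s, f, w, t]) | skip
  · ext <;> simp [s, t, w]
  · rw [hs]; ext <;> simp [a, f, t]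

section Zpow

variable (p : ℕ) (m : ℤ)

theorem t_zpow : t ℤ p ^ m = ⟨m, 0, 0, 0, 0⟩ := by
  induction m using Int.induction_on with
  | zero => rfl
  | succ n ih => rw [zpow_add_one, ih]; ext <;> simp [t]
  | pred n ih => rw [zpow_sub_one, ih]; ext <;> simp [t, sub_eq_add_neg]

theorem a_zpow : a ℤ p ^ m = ⟨0, m, 0, 0, 0⟩ := by
  induction m using Int.induction_on with
  | zero => rfl
  | succ n ih => rw [zpow_add_one, ih]; ext <;> simp [a]
  | pred n ih => rw [zpow_sub_one, ih]; ext <;> simp [a, sub_eq_add_neg]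

theorem s_zpow : s ℤ p ^ m = ⟨0, 0, m, 0, 0⟩ := by
  induction m using Int.induction_on with
  | zero => rfl
  | succ n ih => rw [zpow_add_one, ih]; ext <;> simp [s]
  | pred n ih => rw [zpow_sub_one, ih]; ext <;> simp [s, sub_eq_add_neg]

theorem f_zpow : f ℤ p ^ m = ⟨0, 0, 0, m, 0⟩ := by
  induction m using Int.induction_on with
  | zero => rfl
  | succ n ih => rw [zpow_add_one, ih]; ext <;> simp [f]
  | pred n ih => rw [zpow_sub_one, ih]; ext <;> simp [f, sub_eq_add_neg]

theorem w_zpow : w ℤ p ^ m = ⟨0, 0, 0, 0, m⟩ := by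
  induction m using Int.induction_on with
  | zero => rfl
  | succ n ih => rw [zpow_add_one, ih]; ext <;> simp [w]
  | pred n ih => rw [zpow_sub_one, ih]; ext <;> simp [w, sub_eq_add_neg]

theorem f_zpow_mul_w_zpow (n : ℤ) : f ℤ p ^ m * w ℤ p ^ n = ⟨0, 0, 0, m, n⟩ := by
  rw [f_zpow, w_zpow]
  ext <;> simp

theorem t_zpow_mul_monomial (g : Model ℤ p) :
    t ℤ p ^ g.k * (a ℤ p ^ g.x * s ℤ p ^ g.y * f ℤ p ^ g.z * w ℤ p ^ g.u) = g := by
  simp only [t_zpow, a_zpow, s_zpow, f_zpow, w_zpow]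
  ext <;> simp

end Zpow

theorem exists_eq_of_mem_center {p : ℕ} {g : Model ℤ p}
    (hg : g ∈ Subgroup.center (Model ℤ p)) : ∃ m n : ℤ, g = f ℤ p ^ m * w ℤ p ^ n := by
  rw [Subgroup.mem_center_iff] at hg
  -- Commuting with a forces k = 0; commuting with t forces x = y = 0.
  have h1 := commute_iff.1 (hg (a ℤ p))
  have h2 := commute_iff.1 (hg (t ℤ p))
  simp [a, t] at h1 h2
  refine ⟨g.z, g.u, ?_⟩
  rw [f_zpow_mul_w_zpow]
  ext <;> simp [h1.1, ← h2.1, ← h2.2]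

/-- The homomorphism to `ℤ` with `s ↦ 1` and `f ↦ p`. -/
def chi (p : ℕ) : Model ℤ p →* Multiplicative ℤ where
  toFun g := Multiplicative.ofAdd (g.y + p * g.z)
  map_one' := by simp
  -- The terms p·h.k·g.x in `y` and -h.k·g.x in `z` cancel in y + p z.
  map_mul' g h := by
    rw [← ofAdd_add]
    congr 1
    simp only [mul_y, mul_z]
    ring

theorem chi_f (p : ℕ) : chi p (f ℤ p) = Multiplicative.ofAdd (p : ℤ) := by
  simp [chi, f]

end Model

/-- The product `a ^ x * s ^ y * f ^ z * w ^ u`. -/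
def monomial {G : Type*} [Group G] (a s f w : G) (x y z u : ℤ) : G :=
  a ^ x * s ^ y * f ^ z * w ^ u

/-! ### Collection of words from the relations -/

namespace Relations

variable {G : Type*} [Group G] {p : ℕ} {a s f w t : G} (r : Relations p a s f w t)
include r

theorem monomial_mul (x y z u x' y' z' u' : ℤ) :
    monomial a s f w x y z u * monomial a s f w x' y' z' u' =
      monomial a s f w (x + x') (y + y') (z + z') (u + u') := by
  have e := fun {g h : G} (H : Commute g h) (i j : ℤ) (l : G) =>
    (H.zpow_zpow j i).symm.left_comm l
  simp only [monomial, zpow_add, mul_assoc, e r.as, e r.af, e r.aw, e r.sf, e r.sw, e r.fw]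

theorem monomial_mul_t (x y z u : ℤ) :
    monomial a s f w x y z u * t = t * monomial a s f w x (y + p * x) (z - x) (u + y) := by
  -- Each relation gives the conjugate of one generator by t; semiconjugation is multiplicative, so
  -- it extends to monomials.
  have ha : SemiconjBy t (a * (s ^ p * f⁻¹)) a := r.at_.symm
  have hs : SemiconjBy t (s * w) s := r.st.symm
  have hf : SemiconjBy t f f := r.tf
  have hw : SemiconjBy t w w := r.tw
  have h := (((ha.zpow_right x).mul_right (hs.zpow_right y)).mul_right
    (hf.zpow_right z)).mul_right (hw.zpow_right u)
  rw [monomial, ← h.eq]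
  congr 1
  have h1 : (a * (s ^ p * f⁻¹)) ^ x = monomial a s f w x (p * x) (-x) 0 := by
    rw [((r.as.pow_right p).mul_right r.af.inv_right).mul_zpow,
      (r.sf.pow_left p).inv_right.mul_zpow, ← zpow_natCast, ← zpow_mul, inv_zpow']
    simp [monomial, mul_assoc]
  have h2 : (s * w) ^ y = monomial a s f w 0 y 0 y := by
    rw [r.sw.mul_zpow]; simp [monomial]
  have h3 : f ^ z * w ^ u = monomial a s f w 0 0 z u := by simp [monomial]
  rw [h1, h2, mul_assoc _ (f ^ z), h3, r.monomial_mul, r.monomial_mul]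
  congr 1 <;> ring

theorem monomial_mul_t_zpow (l x y z u : ℤ) :
    monomial a s f w x y z u * t ^ l =
      t ^ l * monomial a s f w x (y + p * l * x) (z - l * x)
        (u + l * y + p * Ring.choose l 2 * x) := by
  induction l using Int.induction_on generalizing x y z u with
  | zero => simp
  | succ n ih =>
    rw [zpow_add_one, ← mul_assoc, ih, mul_assoc, r.monomial_mul_t, mul_assoc (t ^ _)]
    congr 3
    · ring
    · ring
    · rw [choose_two_add, choose_two_one]; ring
  | pred n ih =>
    rw [zpow_sub_one, ← mul_assoc, ih, mul_assoc (t ^ _), mul_assoc (t ^ _)]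
    congr 1
    rw [mul_inv_eq_iff_eq_mul, mul_assoc t⁻¹, r.monomial_mul_t, inv_mul_cancel_left]
    congr 1
    · ring
    · ring
    · rw [sub_eq_add_neg, choose_two_add, choose_two_neg, choose_two_neg, choose_two_one]; ring

/-- The homomorphism from the coordinate group to a group satisfying the relations. -/
def hom : Model ℤ p →* G where
  toFun g := t ^ g.k * monomial a s f w g.x g.y g.z g.u
  map_one' := by simp [monomial]
  map_mul' g h := by
    rw [mul_assoc, ← mul_assoc _ (t ^ h.k), r.monomial_mul_t_zpow, mul_assoc (t ^ h.k),
      r.monomial_mul, ← mul_assoc, ← zpow_add]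
    rfl

theorem hom_apply (g : Model ℤ p) :
    hom r g = t ^ g.k * monomial a s f w g.x g.y g.z g.u := rfl

theorem hom_a : hom r (Model.a ℤ p) = a := by simp [hom_apply, monomial, Model.a]
theorem hom_s : hom r (Model.s ℤ p) = s := by simp [hom_apply, monomial, Model.s]
theorem hom_f : hom r (Model.f ℤ p) = f := by simp [hom_apply, monomial, Model.f]
theorem hom_w : hom r (Model.w ℤ p) = w := by simp [hom_apply, monomial, Model.w]
theorem hom_t : hom r (Model.t ℤ p) = t := by simp [hom_apply, monomial, Model.t]

theorem range_hom : (hom r).range = Subgroup.closure {a, s, f, w, t} := by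
  apply le_antisymm
  · rintro _ ⟨g, rfl⟩
    have h : ∀ l ∈ ({a, s, f, w, t} : Set G), l ∈ Subgroup.closure {a, s, f, w, t} :=
      fun l hl => Subgroup.subset_closure hl
    simp only [Set.mem_insert_iff, Set.mem_singleton_iff, forall_eq_or_imp, forall_eq] at h
    rw [hom_apply, monomial]
    obtain ⟨ha, hs, hf, hw, ht⟩ := h
    exact mul_mem (zpow_mem ht _) (mul_mem (mul_mem (mul_mem (zpow_mem ha _) (zpow_mem hs _))
      (zpow_mem hf _)) (zpow_mem hw _))
  · rw [Subgroup.closure_le]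
    rintro _ (rfl | rfl | rfl | rfl | rfl)
    exacts [⟨_, r.hom_a⟩, ⟨_, r.hom_s⟩, ⟨_, r.hom_f⟩, ⟨_, r.hom_w⟩, ⟨_, r.hom_t⟩]

end Relations

/-! ### The group `K` -/

/-- The relations of `K` with `s = b * f` and `w = c`. -/
theorem K.relations :
    Relations 1 ((B.a, 1) : K) (K.b * K.f) K.f (B.c, 1) (B.t, 1) := by
  have hof : ∀ x y : A, Commute (HNNExtension.of x : B) (HNNExtension.of y) := fun x y =>
    (Commute.all x y).map _
  have hab : Commute B.a B.b := hof _ _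
  have hac : Commute B.a B.c := hof _ _
  have hbc : Commute B.b B.c := hof _ _
  have e1 : B.a * B.t = B.t * (B.a * B.b) := by rw [← B.conj_a]; group
  have e2 : B.b * B.t = B.t * (B.b * B.c) := by rw [← B.conj_b]; group
  have e3 : B.t * B.c = B.c * B.t := by nth_rw 1 [← B.conj_c]; group
  have hab' := hab.eq
  have hac' := hac.eq
  have hbc' := hbc.eq
  constructor <;>
    simp [commute_iff_eq, K.b, K.f, e1, e2, e3, hab', hac', hbc', ← ofAdd_neg, ← ofAdd_add]

/-- The coordinates of an element of `K`. -/
def K.toModel : K →* Model ℤ 1 := 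
  MonoidHom.noncommCoprod
    (HNNExtension.lift
      -- With s = bf one has b = s f⁻¹, which puts the exponent of b into `y` and its negative into
      -- `z`.
      { toFun := fun v : A => (⟨0, v.toAdd.1, v.toAdd.2.1, -v.toAdd.2.1, v.toAdd.2.2⟩ : Model ℤ 1)
        map_one' := by ext <;> simp
        map_mul' := fun v v' => by ext <;> simp [add_comm] }
      (Model.t ℤ 1)
      (fun v => by
        obtain ⟨v, -⟩ := v
        ext <;> simp [Model.t, A.theta]))
    (zpowersHom _ (Model.f ℤ 1))
    (fun m n => by
      rw [zpowersHom_apply]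
      apply Commute.zpow_right
      rw [Model.commute_iff]
      simp [Model.f])

theorem K.toModel_relations (g : Model ℤ 1) : K.toModel (Relations.hom K.relations g) = g := by
  have ha : K.toModel (B.a, 1) = Model.a ℤ 1 := by
    simp [K.toModel, B.a, A.a, Model.a]
  have hb : K.toModel (K.b * K.f) = Model.s ℤ 1 := by
    ext <;> simp [K.toModel, B.b, A.b, Model.s, K.b, K.f, Model.f]
  have hf : K.toModel K.f = Model.f ℤ 1 := by
    simp [K.toModel, K.f]
  have hc : K.toModel (B.c, 1) = Model.w ℤ 1 := by
    simp [K.toModel, B.c, A.c, Model.w]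
  have ht : K.toModel (B.t, 1) = Model.t ℤ 1 := by
    simp [K.toModel, B.t]
  rw [Relations.hom_apply]
  simp only [map_mul, map_zpow, monomial, ha, hb, hf, hc, ht]
  exact Model.t_zpow_mul_monomial 1 g

/-- Together with the left inverse `K.toModel` this identifies K with `Model ℤ 1`. -/
theorem K.surjective_hom : Function.Surjective (Relations.hom K.relations) := by
  rw [← MonoidHom.range_eq_top, eq_top_iff]
  set N := (Relations.hom K.relations).range with hN
  have hmem : ∀ l ∈ ({(B.a, 1), K.b * K.f, K.f, (B.c, 1), (B.t, 1)} : Set K), l ∈ N := by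
    rw [hN, Relations.range_hom]
    exact fun l hl => Subgroup.subset_closure hl
  simp only [Set.mem_insert_iff, Set.mem_singleton_iff, forall_eq_or_imp, forall_eq] at hmem
  obtain ⟨ha, hbf, hf, hc, ht⟩ := hmem
  have hb : K.b ∈ N := (Subgroup.mul_mem_cancel_right N hf).1 hbf
  have hB : ∀ g : B, (g, (1 : Multiplicative ℤ)) ∈ N := by
    intro g
    induction g using HNNExtension.induction_on with
    | of v =>
      have e : ((HNNExtension.of v : B), (1 : Multiplicative ℤ)) =
          (B.a, 1) ^ v.toAdd.1 * K.b ^ v.toAdd.2.1 * (B.c, 1) ^ v.toAdd.2.2 := by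
        simp only [K.b, B.a, B.b, B.c, Prod.pow_mk, one_zpow, Prod.mk_mul_mk, mul_one,
          ← map_zpow, ← map_mul]
        congr 2
        simp [A.a, A.b, A.c, ← ofAdd_zsmul, ← ofAdd_add]
      rw [e]
      exact mul_mem (mul_mem (zpow_mem ha _) (zpow_mem hb _)) (zpow_mem hc _)
    | t => exact ht
    | mul x y hx hy => simpa using mul_mem hx hy
    | inv x hx => simpa using inv_mem hx
  rintro ⟨g, m⟩ -
  have e : (g, m) = (g, 1) * K.f ^ m.toAdd := by
    simp [K.f, ← ofAdd_zsmul]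
  rw [e]
  exact mul_mem (hB g) (zpow_mem hf _)

theorem K.injective_toModel : Function.Injective K.toModel := by
  intro g h e
  obtain ⟨g, rfl⟩ := K.surjective_hom g
  obtain ⟨h, rfl⟩ := K.surjective_hom h
  rw [K.toModel_relations, K.toModel_relations] at e
  rw [e]

/-! ### The rational tuples form a rational closure of K -/

namespace Model

/-- Extension of scalars. -/
def castHom (p : ℕ) : Model ℤ p →* Model ℚ p where
  toFun g := ⟨g.k, g.x, g.y, g.z, g.u⟩
  map_one' := by ext <;> simp
  map_mul' g h := by
    have e := Ring.map_choose (Int.castRingHom ℚ) h.k 2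
    simp only [eq_intCast] at e
    ext <;> simp [e]

theorem castHom_injective (p : ℕ) : Function.Injective (castHom p) := by
  intro g h e
  simpa [castHom, Model.ext_iff] using e

section

variable {R : Type*} [CommRing R] [BinomialRing R] {p : ℕ}

/-- The class is at most 3: commutators have k = x = 0, commutators of elements with k = x = 0 also
have y = 0, and k = x = y = 0 implies central. -/
theorem isNilpotent : Group.IsNilpotent (Model R p) := by
  have h1 : ∀ g : Model R p, g.k = 0 → g.x = 0 → g.y = 0 →
      g ∈ Subgroup.upperCentralSeries (Model R p) 1 := by
    intro g hk hx hy
    rw [Subgroup.mem_upperCentralSeries_succ_iff]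
    intro h
    rw [Subgroup.upperCentralSeries_zero, Subgroup.mem_bot, commutatorElement_eq_one_iff_commute]
    exact commute_iff.2 (by simp [hk, hx, hy])
  have h2 : ∀ g : Model R p, g.k = 0 → g.x = 0 →
      g ∈ Subgroup.upperCentralSeries (Model R p) 2 := by
    intro g hk hx
    rw [Subgroup.mem_upperCentralSeries_succ_iff]
    intro h
    exact h1 _ (by simp [commutatorElement_def]) (by simp [commutatorElement_def])
      (by simp [commutatorElement_def, hk, hx]; ring)
  refine ⟨3, eq_top_iff.2 fun g _ => ?_⟩
  rw [Subgroup.mem_upperCentralSeries_succ_iff]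
  exact fun h => h2 _ (by simp [commutatorElement_def]) (by simp [commutatorElement_def])

end

theorem pow_eq (g : Model ℚ 1) (n : ℕ) : g ^ n =
    ⟨n * g.k, n * g.x, n * g.y + n * (n - 1) / 2 * g.k * g.x,
      n * g.z - n * (n - 1) / 2 * g.k * g.x,
      n * g.u + n * (n - 1) / 2 * g.k * g.y +
        (n * (n - 1) * (2 * n - 1) / 12 * g.k ^ 2 - n * (n - 1) / 4 * g.k) * g.x⟩ := by
  have hc : Ring.choose g.k 2 = g.k * (g.k - 1) / 2 := by
    linarith [two_mul_choose_two g.k]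
  induction n with
  | zero => ext <;> simp
  | succ n ih =>
    rw [pow_succ, ih]
    ext <;> simp [hc] <;> ring

/-- The power formula is triangular: each coordinate of the power is n times that of the root plus a
polynomial in earlier ones. -/
theorem existsUnique_root (h : Model ℚ 1) (n : ℕ) (hn : 0 < n) : ∃! g : Model ℚ 1, g ^ n = h := by
  have hn' : (n : ℚ) ≠ 0 := by positivity
  set k := h.k / n with hk
  set x := h.x / n with hx
  set y := (h.y - n * (n - 1) / 2 * k * x) / n with hy
  set z := (h.z + n * (n - 1) / 2 * k * x) / n with hz
  set u := (h.u - n * (n - 1) / 2 * k * y -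
        (n * (n - 1) * (2 * n - 1) / 12 * k ^ 2 - n * (n - 1) / 4 * k) * x) / n with hu
  refine ⟨⟨k, x, y, z, u⟩, ?_, ?_⟩
  · dsimp only
    rw [pow_eq]
    refine Model.ext ?_ ?_ ?_ ?_ ?_ <;> dsimp only
    · rw [hk]; field_simp
    · rw [hx]; field_simp
    · rw [hy, mul_div_cancel₀ _ hn']; ring
    · rw [hz, mul_div_cancel₀ _ hn']; ring
    · rw [hu, mul_div_cancel₀ _ hn']; ring
  · rintro g rfl
    simp only [pow_eq] at hk hx hy hz hu
    rw [mul_div_cancel_left₀ _ hn'] at hk hx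
    have hy' : y = g.y := by rw [hy, hk, hx]; field_simp; ring
    have hz' : z = g.z := by rw [hz, hk, hx]; field_simp; ring
    have hu' : u = g.u := by rw [hu, hk, hx, hy']; field_simp; ring
    exact Model.ext hk.symm hx.symm hy'.symm hz'.symm hu'.symm

theorem exists_pow_mem (g : Model ℚ 1) : ∃ n : ℕ, 0 < n ∧ g ^ n ∈ (castHom 1).range := by
  set d := g.k.den * g.x.den * g.y.den * g.z.den * g.u.den with hd
  have hd0 : 0 < d := by
    have := g.k.den_pos; have := g.x.den_pos; have := g.y.den_pos
    have := g.z.den_pos; have := g.u.den_pos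
    positivity
  have key : ∀ q : ℚ, q.den ∣ d → ∃ m : ℤ, (d : ℚ) * q = m := by
    rintro q ⟨e, he⟩
    refine ⟨e * q.num, ?_⟩
    rw [he]
    push_cast
    rw [mul_comm (q.den : ℚ), mul_assoc, mul_comm (q.den : ℚ), Rat.mul_den_eq_num]
  obtain ⟨k, hk⟩ := key g.k ⟨g.x.den * g.y.den * g.z.den * g.u.den, by rw [hd]; ring⟩
  obtain ⟨x, hx⟩ := key g.x ⟨g.k.den * g.y.den * g.z.den * g.u.den, by rw [hd]; ring⟩
  obtain ⟨y, hy⟩ := key g.y ⟨g.k.den * g.x.den * g.z.den * g.u.den, by rw [hd]; ring⟩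
  obtain ⟨z, hz⟩ := key g.z ⟨g.k.den * g.x.den * g.y.den * g.u.den, by rw [hd]; ring⟩
  obtain ⟨u, hu⟩ := key g.u ⟨g.k.den * g.x.den * g.y.den * g.z.den, by rw [hd]; ring⟩
  -- The power formula has denominators dividing 12 and products of at most three coordinates, each
  -- integral after multiplication by `d`. Below, `N` = n - 1 and `M` = 2n - 1 for this exponent n.
  refine ⟨12 * d ^ 3, by positivity, ?_⟩
  set N : ℤ := 12 * d ^ 3 - 1 with hN
  set M : ℤ := 24 * d ^ 3 - 1 with hM
  refine ⟨⟨12 * d ^ 2 * k, 12 * d ^ 2 * x, 12 * d ^ 2 * y + 6 * d * N * k * x,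
    12 * d ^ 2 * z - 6 * d * N * k * x,
    12 * d ^ 2 * u + 6 * d * N * k * y + (N * M * k ^ 2 - 3 * d * N * k) * x⟩, ?_⟩
  rw [pow_eq]
  ext <;> simp [castHom, hN, hM, ← hk, ← hx, ← hy, ← hz, ← hu] <;> ring

end Model

/-- The embedding of `K` in its rational closure. -/
noncomputable def K.toRationalModel : K →* Model ℚ 1 := (Model.castHom 1).comp K.toModel

theorem K.isRationalClosure_toRationalModel : IsRationalClosure K.toRationalModel where
  nilpotent := Model.isNilpotent
  torsionFree g hg h := by
    obtain ⟨n, hn, e⟩ := isOfFinOrder_iff_pow_eq_one.1 h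
    exact hg ((Model.existsUnique_root 1 n hn).unique e (one_pow n))
  injective := (Model.castHom_injective 1).comp K.injective_toModel
  existsUnique_root := Model.existsUnique_root
  exists_pow_mem h := by
    obtain ⟨n, hn, g, hg⟩ := Model.exists_pow_mem h
    refine ⟨n, hn, Relations.hom K.relations g, ?_⟩
    rw [← hg, K.toRationalModel, MonoidHom.comp_apply, K.toModel_relations]

theorem Relations.monomial_pow {G : Type*} [Group G] {p : ℕ} {a s f w t : G}
    (r : Relations p a s f w t) (x y z u : ℤ) (n : ℕ) :
    monomial a s f w x y z u ^ n = monomial a s f w (n * x) (n * y) (n * z) (n * u) := by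
  induction n with
  | zero => simp [monomial]
  | succ n ih =>
    rw [pow_succ, ih, r.monomial_mul]
    push_cast
    congr 1 <;> ring

/-! ### G_p inside an arbitrary rational closure -/

namespace IsRationalClosure

section

variable {G R : Type*} [Group G] [Group R] {ι : G →* R} (hι : IsRationalClosure ι)
include hι

theorem eq_of_pow_eq {g h : R} {n : ℕ} (hn : 0 < n) (e : g ^ n = h ^ n) : g = h :=
  (hι.existsUnique_root (h ^ n) n hn).unique e rfl

theorem commute_of_pow {g h : R} {n : ℕ} (hn : 0 < n) (e : Commute (g ^ n) h) : Commute g h := by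
  have : h * g * h⁻¹ = g := by
    apply hι.eq_of_pow_eq hn
    rw [conj_pow, ← e.eq, mul_inv_cancel_right]
  exact (mul_inv_eq_iff_eq_mul.1 this).symm

end

variable {R : Type*} [Group R] {ι : K →* R} (hι : IsRationalClosure ι)
include hι

/-- Relations involving s or w are inherited from K: uniqueness of roots lets p-th powers be
cancelled, also inside commutation relations. -/
theorem relations {p : ℕ} (hp : 0 < p) {s w : R} (hs : s ^ p = ι (K.b * K.f))
    (hw : w ^ p = ι (B.c, 1)) :
    Relations p (ι (B.a, 1)) s (ι K.f) w (ι (B.t, 1)) := by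
  have r := K.relations
  have root := fun {g h : R} (e : Commute (g ^ p) h) => hι.commute_of_pow hp e
  have cs : Commute (ι (B.c, 1)) s := by
    refine (root ?_).symm
    rw [hs]
    exact r.sw.map ι
  have sw : Commute s w := by
    refine (root ?_).symm
    rwa [hw]
  refine ⟨(root ?_).symm, r.af.map ι, (root ?_).symm, root ?_, sw, (root ?_).symm, r.tf.map ι,
    (root ?_).symm, ?_, ?_⟩
  · rw [hs]; exact r.as.symm.map ι
  · rw [hw]; exact r.aw.symm.map ι
  · rw [hs]; exact r.sf.map ι
  · rw [hw]; exact r.fw.symm.map ι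
  · rw [hw]; exact r.tw.symm.map ι
  · have : (ι (B.t, 1))⁻¹ * s * ι (B.t, 1) = s * w := by
      apply hι.eq_of_pow_eq hp
      have e := conj_pow (i := p) (a := (ι (B.t, 1))⁻¹) (b := s)
      rw [inv_inv] at e
      rw [e, sw.mul_pow, hs, hw, mul_assoc, ← map_mul, r.st, map_mul, inv_mul_cancel_left, map_mul]
    rw [← this]; group
  · rw [hs]
    simpa only [map_mul, map_inv, pow_one] using congrArg ι r.at_

theorem hom_injective {p : ℕ} (hp : 0 < p) {s w : R} (hs : s ^ p = ι (K.b * K.f))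
    (hw : w ^ p = ι (B.c, 1)) : Function.Injective (Relations.hom (hι.relations hp hs hw)) := by
  rw [injective_iff_map_eq_one]
  intro g hg
  have r := hι.relations hp hs hw
  rw [Relations.hom_apply] at hg
  have h1 := congrArg (· ^ p) (eq_inv_of_mul_eq_one_right hg)
  -- The p-th power of the abelian part involves s and w only through s^p = bf and w^p = c, so the
  -- equation becomes one in K.
  simp only [r.monomial_pow] at h1
  have h2 : ι (Relations.hom K.relations ⟨p * g.k, p * g.x, g.y, p * g.z, g.u⟩) = 1 := by
    rw [Relations.hom_apply]
    simp only [monomial, map_mul, map_zpow] at h1 ⊢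
    rw [← map_mul, ← hs, ← hw, ← zpow_natCast s, ← zpow_natCast w, ← zpow_mul, ← zpow_mul, h1,
      mul_comm, zpow_mul, zpow_natCast, inv_pow, mul_inv_cancel]
  have h3 := hι.injective (h2.trans (map_one ι).symm)
  have h4 := congrArg K.toModel h3
  rw [K.toModel_relations, map_one, Model.ext_iff] at h4
  have hp' : (p : ℤ) ≠ 0 := by positivity
  simp only [Model.one_k, Model.one_x, Model.one_y, Model.one_z, Model.one_u, mul_eq_zero, hp',
    false_or] at h4
  exact Model.ext h4.1 h4.2.1 h4.2.2.1 h4.2.2.2.1 h4.2.2.2.2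

theorem range_hom {p : ℕ} (hp : 0 < p) {s w : R} (hs : s ^ p = ι (K.b * K.f))
    (hw : w ^ p = ι (B.c, 1)) :
    (Relations.hom (hι.relations hp hs hw)).range = baumslagGroup ι p := by
  have r := hι.relations hp hs hw
  have hsG : s ∈ baumslagGroup ι p := Subgroup.subset_closure (.inr hs)
  have hιG : ∀ g, ι g ∈ baumslagGroup ι p := fun g => Subgroup.subset_closure (.inl ⟨g, rfl⟩)
  have hw' : w = s⁻¹ * ((ι (B.t, 1))⁻¹ * (s * ι (B.t, 1))) := by
    rw [r.st]; group
  apply le_antisymm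
  · rw [Relations.range_hom, Subgroup.closure_le]
    rintro _ (rfl | rfl | rfl | rfl | rfl)
    · exact hιG _
    · exact hsG
    · exact hιG _
    · rw [hw']
      exact mul_mem (inv_mem hsG) (mul_mem (inv_mem (hιG _)) (mul_mem hsG (hιG _)))
    · exact hιG _
  · set N := (Relations.hom (hι.relations hp hs hw)).range with hN
    have hmem : ∀ l ∈ ({ι (B.a, 1), s, ι K.f, w, ι (B.t, 1)} : Set R), l ∈ N := by
      rw [hN, Relations.range_hom]
      exact fun l hl => Subgroup.subset_closure hl
    simp only [Set.mem_insert_iff, Set.mem_singleton_iff, forall_eq_or_imp, forall_eq] at hmem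
    obtain ⟨ha, hs', hf, hw', ht⟩ := hmem
    rw [baumslagGroup, Subgroup.closure_le]
    rintro _ (⟨g, rfl⟩ | e)
    · obtain ⟨g, rfl⟩ := K.surjective_hom g
      rw [Relations.hom_apply, monomial]
      simp only [map_mul, map_zpow]
      rw [← map_mul, ← hs, ← hw]
      exact mul_mem (zpow_mem ht _) (mul_mem (mul_mem (mul_mem (zpow_mem ha _)
        (zpow_mem (pow_mem hs' _) _)) (zpow_mem hf _)) (zpow_mem (pow_mem hw' _) _))
    -- Uniqueness of roots: the generating set contains no p-th root of bf other than s.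
    · rwa [hι.eq_of_pow_eq hp (Eq.trans e hs.symm)]

/-- Baumslag's group is isomorphic to its coordinate model. -/
theorem exists_mulEquiv {p : ℕ} (hp : 0 < p) :
    ∃ e : Model ℤ p ≃* baumslagGroup ι p, e (Model.f ℤ p) = baumslagGroup.f ι p := by
  obtain ⟨s, hs, -⟩ := hι.existsUnique_root (ι (K.b * K.f)) p hp
  obtain ⟨w, hw, -⟩ := hι.existsUnique_root (ι (B.c, 1)) p hp
  refine ⟨(MonoidHom.ofInjective (hι.hom_injective hp hs hw)).trans
    (MulEquiv.subgroupCongr (hι.range_hom hp hs hw)), Subtype.ext ?_⟩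
  exact (hι.relations hp hs hw).hom_f

end IsRationalClosure

/-! ### Abstract properties of G_p -/

theorem TorsionFree.of_injective {G H : Type*} [Group G] [Group H] (hH : TorsionFree H)
    {φ : G →* H} (hφ : Function.Injective φ) : TorsionFree G := fun g hg h =>
  hH (φ g) (by rwa [Ne, map_eq_one_iff φ hφ]) (φ.isOfFinOrder h)

theorem TorsionFree.prod {G H : Type*} [Group G] [Group H] (hG : TorsionFree G)
    (hH : TorsionFree H) : TorsionFree (G × H) := by
  intro g hg h
  have h1 : g.1 = 1 := by_contra fun e => hG _ e ((MonoidHom.fst G H).isOfFinOrder h)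
  have h2 : g.2 = 1 := by_contra fun e => hH _ e ((MonoidHom.snd G H).isOfFinOrder h)
  exact hg (Prod.ext h1 h2)

theorem TorsionFree.eq_one_of_zpow_eq_one {G : Type*} [Group G] (hG : TorsionFree G) {g : G}
    {n : ℤ} (hn : n ≠ 0) (h : g ^ n = 1) : g = 1 :=
  by_contra fun e => hG g e (isOfFinOrder_iff_zpow_eq_one.2 ⟨n, hn, h⟩)

/-- A group without two commuting pairs of noncommuting elements. -/
def NoCommutingPairs (G : Type*) [Group G] : Prop :=
  ∀ g h g' h' : G, Commute g g' → Commute g h' → Commute h g' → Commute h h' →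
    Commute g h ∨ Commute g' h'

theorem NoCommutingPairs.of_injective {G H : Type*} [Group G] [Group H] (hH : NoCommutingPairs H)
    {φ : G →* H} (hφ : Function.Injective φ) : NoCommutingPairs G := fun g h g' h' h1 h2 h3 h4 =>
  (hH (φ g) (φ h) (φ g') (φ h') (h1.map φ) (h2.map φ) (h3.map φ) (h4.map φ)).imp
    (fun e => hφ (by simpa using e.eq)) (fun e => hφ (by simpa using e.eq))

/-- The properties of Baumslag's group on which the failure of unique decomposition rests. -/
structure IsBaumslag {G : Type*} [Group G] (p : ℕ) (f : G) : Prop where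
  noCommutingPairs : NoCommutingPairs G
  torsionFree : TorsionFree G
  exists_relations : ∃ a s w t : G, Relations p a s f w t ∧ ¬ Commute a t ∧
    f ∈ Subgroup.center G ∧ w ∈ Subgroup.center G ∧
    (∀ g ∈ Subgroup.center G, ∃ m n : ℤ, g = f ^ m * w ^ n) ∧
    ∀ m n : ℤ, f ^ m * w ^ n = 1 → m = 0 ∧ n = 0
  exists_hom : ∃ χ : G →* Multiplicative ℤ, χ f = Multiplicative.ofAdd (p : ℤ)

theorem Relations.map {G H : Type*} [Group G] [Group H] {p : ℕ} {a s f w t : G}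
    (r : Relations p a s f w t) (φ : G →* H) : Relations p (φ a) (φ s) (φ f) (φ w) (φ t) where
  as := r.as.map φ
  af := r.af.map φ
  aw := r.aw.map φ
  sf := r.sf.map φ
  sw := r.sw.map φ
  fw := r.fw.map φ
  tf := r.tf.map φ
  tw := r.tw.map φ
  st := by simpa using congrArg φ r.st
  at_ := by simpa using congrArg φ r.at_

theorem IsBaumslag.of_mulEquiv {G : Type*} [Group G] {p : ℕ} {f : G} (e : Model ℤ p ≃* G)
    (he : e (Model.f ℤ p) = f) (hG : TorsionFree G) : IsBaumslag p f where
  noCommutingPairs := NoCommutingPairs.of_injective (H := Model ℤ p)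
    (fun _ _ _ _ => Model.commute_or_commute) (φ := e.symm.toMonoidHom) e.symm.injective
  torsionFree := hG
  exists_relations := by
    have hc : ∀ g : Model ℤ p, g ∈ Subgroup.center _ → e g ∈ Subgroup.center G := by
      intro g hg
      rw [Subgroup.mem_center_iff] at hg ⊢
      intro h
      obtain ⟨h, rfl⟩ := e.surjective h
      rw [← map_mul, hg, map_mul]
    have r := (Model.relations ℤ p).map e.toMonoidHom
    refine ⟨e (Model.a ℤ p), e (Model.s ℤ p), e (Model.w ℤ p), e (Model.t ℤ p), he ▸ r, ?_,
      he ▸ hc _ ?_, hc _ ?_, ?_, ?_⟩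
    · intro h
      have h' := Model.commute_iff.1 (h.map e.symm.toMonoidHom)
      simp [Model.a, Model.t] at h'
    · rw [Subgroup.mem_center_iff]
      exact fun g => Model.commute_iff.2 (by simp [Model.f])
    · rw [Subgroup.mem_center_iff]
      exact fun g => Model.commute_iff.2 (by simp [Model.w])
    · intro g hg
      obtain ⟨m, n, h⟩ := Model.exists_eq_of_mem_center (g := e.symm g) (by
        rw [Subgroup.mem_center_iff] at hg ⊢
        intro h
        apply e.injective
        simpa using hg (e h))
      refine ⟨m, n, ?_⟩
      rw [← he, ← map_zpow, ← map_zpow, ← map_mul, ← h, e.apply_symm_apply]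
    · intro m n h
      rw [← he, ← map_zpow, ← map_zpow, ← map_mul, MulEquiv.map_eq_one_iff,
        Model.f_zpow_mul_w_zpow, Model.ext_iff] at h
      exact h.2.2.2
  exists_hom := ⟨(Model.chi p).comp e.symm.toMonoidHom, by simp [← he, Model.chi_f]⟩

theorem IsRationalClosure.isBaumslag {R : Type*} [Group R] {ι : K →* R}
    (hι : IsRationalClosure ι) {p : ℕ} (hp : 0 < p) : IsBaumslag p (baumslagGroup.f ι p) := by
  obtain ⟨e, he⟩ := hι.exists_mulEquiv hp
  exact .of_mulEquiv e he (hι.torsionFree.of_injective (Subgroup.subtype_injective _))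

theorem Model.fg (p : ℕ) : Group.FG (Model ℤ p) := by
  rw [Group.fg_iff]
  refine ⟨{a ℤ p, s ℤ p, f ℤ p, w ℤ p, t ℤ p}, ?_, by simp⟩
  rw [← Relations.range_hom (relations ℤ p), MonoidHom.range_eq_top]
  exact fun g => ⟨g, t_zpow_mul_monomial p g⟩

theorem IsRationalClosure.fg_baumslagGroup {R : Type*} [Group R] {ι : K →* R}
    (hι : IsRationalClosure ι) {p : ℕ} (hp : 0 < p) : Group.FG (baumslagGroup ι p) := by
  obtain ⟨e, -⟩ := hι.exists_mulEquiv hp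
  have := Model.fg p
  exact Group.fg_of_surjective (f := e.toMonoidHom) e.surjective

/-! ### Direct decompositions and indecomposability of G_p -/

section Projections

variable {G : Type*} [Group G] {H L : Subgroup G}

/-- The isomorphism of an internal direct product with the external one. -/
noncomputable def prodMulEquivOfIsCompl (hH : H.Normal) (hL : L.Normal) (h : IsCompl H L) :
    H × L ≃* G :=
  MulEquiv.ofBijective
    ({ toFun := fun x => x.1 * x.2
       map_one' := by simp
       map_mul' := fun x y => by
        have e := Subgroup.commute_of_normal_of_disjoint H L hH hL h.disjoint y.1 x.2 y.1.2 x.2.2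
        simp only [Prod.fst_mul, Prod.snd_mul, Subgroup.coe_mul, mul_assoc, e.left_comm] } :
      H × L →* G)
    (by
      constructor
      · rw [injective_iff_map_eq_one]
        rintro ⟨x, y⟩ (e : (x : G) * y = 1)
        have hx : (x : G) ∈ H ⊓ L := ⟨x.2, show _ ∈ L by
          rw [eq_inv_of_mul_eq_one_left e]; exact inv_mem y.2⟩
        rw [h.inf_eq_bot, Subgroup.mem_bot] at hx
        rw [hx, one_mul] at e
        exact Prod.ext (Subtype.ext hx) (Subtype.ext e)
      · intro g
        have hg : g ∈ H ⊔ L := by rw [h.sup_eq_top]; trivial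
        obtain ⟨x, hx, y, hy, rfl⟩ := Subgroup.mem_sup_of_normal_right.1 hg
        exact ⟨(⟨x, hx⟩, ⟨y, hy⟩), rfl⟩)

theorem exists_projections (hH : H.Normal) (hL : L.Normal) (h : IsCompl H L) :
    ∃ (α : G →* H) (β : G →* L), (∀ g, (α g * β g : G) = g) ∧ (∀ x : H, α x = x) ∧
      (∀ y : L, β y = y) ∧ (∀ x : H, β x = 1) ∧ ∀ y : L, α y = 1 := by
  set e := prodMulEquivOfIsCompl hH hL h
  have he : ∀ x y, e (x, y) = x * y := fun _ _ => rfl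
  have hx : ∀ x : H, e.symm x = (x, 1) := fun x => by
    rw [MulEquiv.symm_apply_eq, he]; simp
  have hy : ∀ y : L, e.symm y = (1, y) := fun y => by
    rw [MulEquiv.symm_apply_eq, he]; simp
  refine ⟨(MonoidHom.fst H L).comp e.symm, (MonoidHom.snd H L).comp e.symm, fun g => ?_,
    fun x => ?_, fun y => ?_, fun x => ?_, fun y => ?_⟩
  · exact (he _ _).symm.trans (e.apply_symm_apply g)
  all_goals simp [hx, hy]

end Projections

theorem directlyIndecomposable_of_isCyclic {G : Type*} [Group G] [IsCyclic G] [Nontrivial G]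
    (hG : TorsionFree G) : DirectlyIndecomposable G := by
  refine ⟨inferInstance, fun H L _ _ h => ?_⟩
  obtain ⟨g, hg⟩ := IsCyclic.exists_generator (α := G)
  by_contra! hne
  obtain ⟨x, hx, hx1⟩ := H.bot_or_exists_ne_one.resolve_left hne.1
  obtain ⟨y, hy, hy1⟩ := L.bot_or_exists_ne_one.resolve_left hne.2
  obtain ⟨m, rfl⟩ := hg x
  obtain ⟨n, rfl⟩ := hg y
  dsimp only at *
  have hn : n ≠ 0 := by rintro rfl; simp at hy1
  -- The powers g^m and g^n share g^(mn), which lies in both factors and is therefore trivial.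
  apply hx1
  apply hG.eq_one_of_zpow_eq_one hn
  rw [← Subgroup.mem_bot, ← h.inf_eq_bot]
  refine ⟨zpow_mem hx n, ?_⟩
  rw [← zpow_mul, mul_comm, zpow_mul]
  exact zpow_mem hy m

/-- Both w and s^p f⁻¹ are commutators with t, so they die when the values commute. -/
theorem Relations.map_w_and_map_f {G X : Type*} [Group G] [Group X] {p : ℕ} {a s f w t : G}
    (r : Relations p a s f w t) (φ : G →* X) (h : ∀ x y, Commute (φ x) (φ y)) :
    φ w = 1 ∧ φ f = φ s ^ p := by
  have h1 := congrArg φ r.st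
  have h2 := congrArg φ r.at_
  rw [map_mul, map_mul, map_mul, (h s t).eq, ← mul_assoc, left_eq_mul] at h1
  rw [map_mul, map_mul, map_mul, (h a t).eq, ← mul_assoc, left_eq_mul, map_mul, map_inv,
    mul_inv_eq_one, map_pow] at h2
  exact ⟨h1, h2.symm⟩

/-- Applied to s itself, the hypothesis gives φ(s)^(pm-1) = 1, and pm ≠ 1 because p > 1. -/
theorem TorsionFree.map_eq_one {G X : Type*} [Group G] [Group X] (hX : TorsionFree X) {p : ℕ}
    (hp : 1 < p) (φ : G →* X) (s : G) (h : ∀ g, ∃ m : ℤ, φ g = (φ s ^ p) ^ m) (g : G) :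
    φ g = 1 := by
  have hs : φ s = 1 := by
    obtain ⟨m, hm⟩ := h s
    have hne : (p : ℤ) * m - 1 ≠ 0 := by
      intro e
      have : (p : ℤ) ∣ 1 := ⟨m, by omega⟩
      have := Int.le_of_dvd one_pos this
      omega
    apply hX.eq_one_of_zpow_eq_one hne
    rw [zpow_sub_one, zpow_mul, zpow_natCast, ← hm, mul_inv_cancel]
  obtain ⟨m, hm⟩ := h g
  simpa [hs] using hm

theorem IsBaumslag.directlyIndecomposable {G : Type*} [Group G] {p : ℕ} (hp : 1 < p) {f : G}
    (hG : IsBaumslag p f) : DirectlyIndecomposable G := by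
  obtain ⟨a, s, w, t, r, hat, -, -, hc, -⟩ := hG.exists_relations
  have key : ∀ H L : Subgroup G, H.Normal → L.Normal → IsCompl H L →
      (∀ x ∈ H, ∀ y ∈ H, Commute x y) → H = ⊥ := by
    intro H L hH hL h hab
    obtain ⟨α, β, hαβ, hα, -, -, -⟩ := exists_projections hH hL h
    have hcen : ∀ g, (α g : G) ∈ Subgroup.center G := by
      intro g
      rw [Subgroup.mem_center_iff]
      intro l
      rw [← hαβ l]
      refine Commute.mul_left (hab _ (α l).2 _ (α g).2) ?_
      exact (Subgroup.commute_of_normal_of_disjoint H L hH hL h.disjoint _ _ (α g).2 (β l).2).symm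
    obtain ⟨hw, hf⟩ := r.map_w_and_map_f α fun x y =>
      Subtype.ext (hab _ (α x).2 _ (α y).2)
    have h1 := (hG.torsionFree.of_injective H.subtype_injective).map_eq_one hp α s fun g => by
      obtain ⟨m, n, e⟩ := hc _ (hcen g)
      refine ⟨m, ?_⟩
      rw [← hα (α g), e, map_mul, map_zpow, map_zpow, hw, hf, one_zpow, mul_one]
    rw [eq_bot_iff]
    intro x hx
    rw [Subgroup.mem_bot]
    exact congrArg Subtype.val ((hα ⟨x, hx⟩).symm.trans (h1 x))
  refine ⟨⟨a, t, fun e => hat (e ▸ Commute.refl a)⟩, fun H L hH hL h => ?_⟩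
  -- A noncommuting pair in H is centralized by L, which forces L to be abelian.
  by_cases hab : ∀ x ∈ H, ∀ y ∈ H, Commute x y
  · exact .inl (key H L hH hL h hab)
  · refine .inr (key L H hL hH h.symm fun x hx y hy => ?_)
    push Not at hab
    obtain ⟨x', hx', y', hy', hne⟩ := hab
    have hcomm := Subgroup.commute_of_normal_of_disjoint H L hH hL h.disjoint
    exact (hG.noCommutingPairs x' y' x y (hcomm _ _ hx' hx) (hcomm _ _ hx' hy) (hcomm _ _ hy' hx)
      (hcomm _ _ hy' hy)).resolve_left hne

theorem mem_center_of_forall_commute {G : Type*} [Group G] {g : G} (h : ∀ l, Commute g l) :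
    g ∈ Subgroup.center G :=
  Subgroup.mem_center_iff.2 fun l => (h l).symm

/-! ### Comparing exponents of f in ⟨f, w⟩ -/

section Exponents

variable {G : Type*} [Group G] {f w : G} (hfw : Commute f w)
include hfw

theorem zpow_mul_zpow_mul (m n i j : ℤ) :
    f ^ m * w ^ n * (f ^ i * w ^ j) = f ^ (m + i) * w ^ (n + j) := by
  rw [zpow_add, zpow_add, mul_assoc, mul_assoc, (hfw.zpow_zpow i n).symm.left_comm]

theorem zpow_mul_zpow_pow (m n : ℤ) (q : ℕ) :
    (f ^ m * w ^ n) ^ q = f ^ (m * q) * w ^ (n * q) := by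
  rw [(hfw.zpow_zpow m n).mul_pow, zpow_mul, zpow_mul, zpow_natCast, zpow_natCast]

theorem zpow_mul_zpow_zpow (m n k : ℤ) :
    (f ^ m * w ^ n) ^ k = f ^ (m * k) * w ^ (n * k) := by
  rw [(hfw.zpow_zpow m n).mul_zpow, zpow_mul, zpow_mul]

variable (h : ∀ m n : ℤ, f ^ m * w ^ n = 1 → m = 0 ∧ n = 0)
include h

theorem exponent_eq {m n i j : ℤ} (e : f ^ m * w ^ n = f ^ i * w ^ j) : m = i := by
  have e' : f ^ (m + -i) * w ^ (n + -j) = 1 := by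
    rw [← zpow_mul_zpow_mul hfw, e, zpow_mul_zpow_mul hfw, add_neg_cancel, add_neg_cancel,
      zpow_zero, zpow_zero, mul_one]
  linarith [(h _ _ e').1]

theorem exponent_eq_of_eq_pow_mul {m n k c l : ℤ} {q : ℕ}
    (e : f ^ m * w ^ n =
      ((f ^ m * w ^ n) ^ q) ^ k * (w ^ c * ((f ^ m * w ^ n) ^ q) ^ l)) :
    m = q * (k + l) * m := by
  have hw : w ^ c = f ^ (0 : ℤ) * w ^ c := by simp
  rw [hw, zpow_mul_zpow_pow hfw, zpow_mul_zpow_zpow hfw, zpow_mul_zpow_zpow hfw,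
    zpow_mul_zpow_mul hfw, zpow_mul_zpow_mul hfw] at e
  linear_combination exponent_eq hfw h e

theorem exponent_eq_of_mul_pow_eq {b l m n i j : ℤ} {p q : ℕ}
    (e : f ^ l * ((f ^ m * w ^ n) ^ q * (f ^ i * w ^ j) ^ p) = f ^ b) :
    l + m * q + i * p = b := by
  have hl : f ^ l = f ^ l * w ^ (0 : ℤ) := by simp
  have hb : f ^ b = f ^ b * w ^ (0 : ℤ) := by simp
  rw [hl, hb, zpow_mul_zpow_pow hfw, zpow_mul_zpow_pow hfw, zpow_mul_zpow_mul hfw,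
    zpow_mul_zpow_mul hfw] at e
  linear_combination exponent_eq hfw h e

end Exponents

theorem eq_zero_of_mul_eq_self {q : ℕ} (hq : 1 < q) {m : ℤ} (h : m = q * m * m) : m = 0 := by
  by_contra hm
  have h1 : (q : ℤ) * m = 1 := mul_right_cancel₀ hm (by linarith)
  have := Int.le_of_dvd one_pos ⟨m, h1.symm⟩
  omega

/-! ### Projections of G_p × G_q that kill T -/

section Product

variable {G₁ G₂ : Type*} [Group G₁] [Group G₂] {p q : ℕ} {f : G₁} {φ : G₂}

theorem IsBaumslag.mem_center {G : Type*} [Group G] {p : ℕ} {f : G} (hG : IsBaumslag p f) :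
    f ∈ Subgroup.center G := by
  obtain ⟨a, s, w, t, -, -, hf, -⟩ := hG.exists_relations
  exact hf

theorem IsBaumslag.eq_zero_of_zpow_eq_one {G : Type*} [Group G] {p : ℕ} {f : G}
    (hG : IsBaumslag p f) {n : ℤ} (h : f ^ n = 1) : n = 0 := by
  obtain ⟨a, s, w, t, -, -, -, -, -, hf⟩ := hG.exists_relations
  exact (hf n 0 (by simpa using h)).1

theorem mk_mem_center (h₁ : IsBaumslag p f) (h₂ : IsBaumslag q φ) :
    (f, φ⁻¹) ∈ Subgroup.center (G₁ × G₂) := by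
  have e₁ := Subgroup.mem_center_iff.1 h₁.mem_center
  have e₂ := Subgroup.mem_center_iff.1 (inv_mem h₂.mem_center)
  exact Subgroup.mem_center_iff.2 fun g => Prod.ext (e₁ g.1) (e₂ g.2)

theorem mk_zpow_mul_eq_one_of_commute (h₁ : IsBaumslag p f) (h₂ : IsBaumslag q φ)
    (hp : 1 < p) {α : G₁ × G₂ →* G₁ × G₂} (hα : ∀ g, α (α g) = α g) (hf : α (f, φ⁻¹) = 1)
    (hc : ∀ g, α g ∈ Subgroup.center (G₁ × G₂)) (g : G₁ × G₂) : α g = 1 := by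
  obtain ⟨a₁, s₁, w₁, t₁, r₁, -, -, -, hc₁, -⟩ := h₁.exists_relations
  obtain ⟨a₂, s₂, w₂, t₂, r₂, -, -, -, hc₂, -⟩ := h₂.exists_relations
  have hab : ∀ x y, Commute (α x) (α y) := fun x y =>
    (Subgroup.mem_center_iff.1 (hc x) (α y)).symm
  obtain ⟨hw₁, hf₁⟩ := r₁.map_w_and_map_f (α.comp (MonoidHom.inl G₁ G₂)) fun x y => hab _ _
  obtain ⟨hw₂, -⟩ := r₂.map_w_and_map_f (α.comp (MonoidHom.inr G₁ G₂)) fun x y => hab _ _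
  simp only [MonoidHom.comp_apply, MonoidHom.inl_apply, MonoidHom.inr_apply] at hw₁ hf₁ hw₂
  -- Modulo T the elements f and φ coincide, so every value of α is a power of α(f) = α(s₁)^p.
  have hφ : α (1, φ) = α (f, 1) := by
    have e : ((f, 1) : G₁ × G₂) = (f, φ⁻¹) * (1, φ) := by simp
    rw [e, map_mul, hf, one_mul]
  refine (h₁.torsionFree.prod h₂.torsionFree).map_eq_one hp α (s₁, 1) (fun g => ?_) g
  have hg := Subgroup.mem_center_iff.1 (hc g)
  obtain ⟨m, n, e₁⟩ := hc₁ (α g).1 (Subgroup.mem_center_iff.2 fun x =>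
    congrArg Prod.fst (hg (x, 1)))
  obtain ⟨i, j, e₂⟩ := hc₂ (α g).2 (Subgroup.mem_center_iff.2 fun x =>
    congrArg Prod.snd (hg (1, x)))
  refine ⟨m + i, ?_⟩
  have e : α g = (f, 1) ^ m * (w₁, 1) ^ n * ((1, φ) ^ i * (1, w₂) ^ j) :=
    Prod.ext (by simpa using e₁) (by simpa using e₂)
  rw [← hα g, e]
  simp only [map_mul, map_zpow, hw₁, hw₂, hφ, hf₁, one_zpow, mul_one, zpow_add]

/-- Complementary projections off `⟨(f, φ⁻¹)⟩` cannot separate the two factors up to the center. -/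
theorem false_of_projections (h₁ : IsBaumslag p f) (h₂ : IsBaumslag q φ) (hp : 1 < p) (hq : 1 < q)
    {τ α β : G₁ × G₂ →* G₁ × G₂} (hsum : ∀ g, τ g * (α g * β g) = g)
    (hτ : ∀ g, τ g ∈ Subgroup.zpowers (f, φ⁻¹)) (hα : ∀ g, α (α g) = α g)
    (hβ : ∀ g, β (β g) = β g) (hfα : α (f, φ⁻¹) = 1) (hfβ : β (f, φ⁻¹) = 1)
    (hcβ : ∀ g, (β g).1 ∈ Subgroup.center G₁) (hcα : ∀ g, (α g).2 ∈ Subgroup.center G₂) :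
    False := by
  obtain ⟨a₁, s₁, w₁, t₁, r₁, -, hfc₁, -, hc₁, hi₁⟩ := h₁.exists_relations
  obtain ⟨a₂, s₂, w₂, t₂, r₂, -, hfc₂, -, hc₂, hi₂⟩ := h₂.exists_relations
  have hz₁ : ∀ n : ℤ, f ^ n = 1 → n = 0 := fun n => h₁.eq_zero_of_zpow_eq_one
  have hz₂ : ∀ n : ℤ, φ ^ n = 1 → n = 0 := fun n => h₂.eq_zero_of_zpow_eq_one
  have hτ₁ : ∀ g, (τ g).1 ∈ Subgroup.center G₁ := by
    intro g
    obtain ⟨n, hn⟩ := hτ g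
    rw [← hn]
    exact zpow_mem hfc₁ n
  have hτ₂ : ∀ g, (τ g).2 ∈ Subgroup.center G₂ := by
    intro g
    obtain ⟨n, hn⟩ := hτ g
    rw [← hn]
    exact zpow_mem (inv_mem hfc₂) n
  -- The second coordinates of τ, α and β at (g, 1) multiply to 1, and those of τ and α are central.
  -- Hence β is central-valued on G₁, and likewise α on G₂.
  have hβ₂ : ∀ g, (β (g, 1)).2 ∈ Subgroup.center G₂ := by
    intro g
    have e : (τ (g, 1)).2 * ((α (g, 1)).2 * (β (g, 1)).2) = 1 := congrArg Prod.snd (hsum (g, 1))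
    rw [← mul_assoc] at e
    rw [eq_inv_of_mul_eq_one_right e]
    exact inv_mem (mul_mem (hτ₂ _) (hcα _))
  have hα₁ : ∀ g, (α (1, g)).1 ∈ Subgroup.center G₁ := by
    intro g
    have e : (τ (1, g)).1 * ((α (1, g)).1 * (β (1, g)).1) = 1 := congrArg Prod.fst (hsum (1, g))
    rw [eq_mul_inv_of_mul_eq (eq_inv_of_mul_eq_one_right e)]
    exact mul_mem (inv_mem (hτ₁ _)) (inv_mem (hcβ _))
  have habβ : ∀ x y, Commute (β (x, 1)) (β (y, 1)) := fun x y => Prod.ext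
    (Subgroup.mem_center_iff.1 (hcβ (y, 1)) _) (Subgroup.mem_center_iff.1 (hβ₂ y) _)
  have habα : ∀ x y, Commute (α (1, x)) (α (1, y)) := fun x y => Prod.ext
    (Subgroup.mem_center_iff.1 (hα₁ y) _) (Subgroup.mem_center_iff.1 (hcα (1, y)) _)
  obtain ⟨hwβ, hfβ₁⟩ := r₁.map_w_and_map_f (β.comp (MonoidHom.inl G₁ G₂)) habβ
  obtain ⟨hwα, hfα₂⟩ := r₂.map_w_and_map_f (α.comp (MonoidHom.inr G₁ G₂)) habα
  have habτ : ∀ x y, Commute (τ x) (τ y) := fun x y => by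
    obtain ⟨m, hm⟩ := hτ x
    obtain ⟨n, hn⟩ := hτ y
    dsimp only at hm hn
    rw [← hm, ← hn]
    exact Commute.zpow_zpow_self _ m n
  obtain ⟨hwτ₁, -⟩ := r₁.map_w_and_map_f (τ.comp (MonoidHom.inl G₁ G₂)) fun x y => habτ _ _
  obtain ⟨hwτ₂, -⟩ := r₂.map_w_and_map_f (τ.comp (MonoidHom.inr G₁ G₂)) fun x y => habτ _ _
  simp only [MonoidHom.comp_apply, MonoidHom.inl_apply, MonoidHom.inr_apply] at *
  -- As a commutator, w₁ is killed by τ and by β, so α fixes it; symmetrically β fixes w₂.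
  have hw₁ : α (w₁, 1) = (w₁, 1) := by simpa [hwτ₁, hwβ] using hsum (w₁, 1)
  have hw₂ : β (1, w₂) = (1, w₂) := by simpa [hwτ₂, hwα] using hsum (1, w₂)
  have e : ((f, 1) : G₁ × G₂) = (f, φ⁻¹) * (1, φ) := by simp
  have hφα : α (1, φ) = α (f, 1) := by rw [e, map_mul, hfα, one_mul]
  have hφβ : β (1, φ) = β (f, 1) := by rw [e, map_mul, hfβ, one_mul]
  obtain ⟨m, n, hy₁⟩ := hc₁ _ (hα₁ s₂)
  obtain ⟨i, j, hy₂⟩ := hc₂ _ (hcα (1, s₂))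
  obtain ⟨m', n', hz₁'⟩ := hc₁ _ (hcβ (s₁, 1))
  obtain ⟨i', j', hz₂'⟩ := hc₂ _ (hβ₂ s₁)
  have hy : α (1, s₂) = (f, 1) ^ m * (w₁, 1) ^ n * ((1, φ) ^ i * (1, w₂) ^ j) :=
    Prod.ext (by simpa using hy₁) (by simpa using hy₂)
  have hz : β (s₁, 1) = (f, 1) ^ m' * (w₁, 1) ^ n' * ((1, φ) ^ i' * (1, w₂) ^ j') :=
    Prod.ext (by simpa using hz₁') (by simpa using hz₂')
  have hy' := congrArg α hy
  have hz' := congrArg β hz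
  simp only [map_mul, map_zpow, hw₁, hwα, ← hφα, hfα₂, hα, one_zpow, mul_one] at hy'
  simp only [map_mul, map_zpow, hw₂, hwβ, hφβ, hfβ₁, hβ, one_zpow, mul_one] at hz'
  -- Idempotence of α at y = α(s₂), where α(f) = α(φ) = y^q, gives m = q(m+i)m and i = q(m+i)i.
  -- Their sum is M = qM² for M = m + i, so M = 0; β is handled with p.
  have hm := exponent_eq_of_eq_pow_mul (l := i) r₁.fw hi₁ (m := m) (n := n) (k := m) (c := n)
    (q := q) (by simpa [hy₁, mul_assoc] using congrArg Prod.fst hy')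
  have hi := exponent_eq_of_eq_pow_mul (l := i) r₂.fw hi₂ (m := i) (n := j) (k := m) (c := 0)
    (q := q) (by simpa [hy₂, mul_assoc] using congrArg Prod.snd hy')
  have hm' := exponent_eq_of_eq_pow_mul (l := i') r₁.fw hi₁ (m := m') (n := n') (k := m') (c := 0)
    (q := p) (by simpa [hz₁', mul_assoc] using congrArg Prod.fst hz')
  have hi' := exponent_eq_of_eq_pow_mul (l := 0) r₂.fw hi₂ (m := i') (n := j') (k := m' + i')
    (c := j') (q := p) (by simpa [hz₂', mul_assoc, zpow_add] using congrArg Prod.snd hz')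
  have hM : m + i = 0 := eq_zero_of_mul_eq_self hq (by linear_combination hm + hi)
  have hM' : m' + i' = 0 := eq_zero_of_mul_eq_self hp (by linear_combination hm' + hi')
  obtain ⟨l, hl⟩ := hτ (f, 1)
  have hf := hsum (f, 1)
  rw [← hl, ← hφα, hfα₂, hfβ₁] at hf
  have e₁ := exponent_eq_of_mul_pow_eq r₁.fw hi₁ (l := l) (m := m) (n := n) (i := m') (j := n')
    (b := 1) (p := p) (q := q) (by simpa [hy₁, hz₁'] using congrArg Prod.fst hf)
  have e₂ := exponent_eq_of_mul_pow_eq r₂.fw hi₂ (l := -l) (m := i) (n := j) (i := i') (j := j')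
    (b := 0) (p := p) (q := q) (by simpa [hy₂, hz₂'] using congrArg Prod.snd hf)
  -- Total exponent of f and φ in (f, 1): 1 on one side; on the other l - l from τ, q(m+i) = 0 from
  -- α and p(m'+i') = 0 from β.
  have : (1 : ℤ) = 0 := by linear_combination -e₁ - e₂ + q * hM + p * hM'
  exact one_ne_zero this

/-- Projections onto the two factors of a direct decomposition of a complement of `⟨(f, φ⁻¹)⟩`. -/
theorem eq_one_or_eq_one_of_projections (h₁ : IsBaumslag p f) (h₂ : IsBaumslag q φ) (hp : 1 < p)
    (hq : 1 < q) {τ α β : G₁ × G₂ →* G₁ × G₂} (hsum : ∀ g, τ g * (α g * β g) = g)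
    (hτ : ∀ g, τ g ∈ Subgroup.zpowers (f, φ⁻¹)) (hα : ∀ g, α (α g) = α g)
    (hβ : ∀ g, β (β g) = β g) (hfα : α (f, φ⁻¹) = 1) (hfβ : β (f, φ⁻¹) = 1)
    (hαβ : ∀ g h, Commute (α g) (β h)) : (∀ g, α g = 1) ∨ ∀ g, β g = 1 := by
  have hτc : ∀ g l, Commute l (τ g) := by
    intro g
    refine Subgroup.mem_center_iff.1 ?_
    obtain ⟨n, hn⟩ := hτ g
    rw [← hn]
    exact zpow_mem (mk_mem_center h₁ h₂) n
  by_cases hα' : ∀ g h, Commute (α g) (α h)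
  · left
    refine mk_zpow_mul_eq_one_of_commute h₁ h₂ hp hα hfα fun g => ?_
    refine mem_center_of_forall_commute fun l => ?_
    rw [← hsum l]
    exact (hτc _ _).mul_right ((hα' _ _).mul_right (hαβ _ _))
  by_cases hβ' : ∀ g h, Commute (β g) (β h)
  · right
    refine mk_zpow_mul_eq_one_of_commute h₁ h₂ hp hβ hfβ fun g => ?_
    refine mem_center_of_forall_commute fun l => ?_
    rw [← hsum l]
    exact (hτc _ _).mul_right ((hαβ _ _).symm.mul_right (hβ' _ _))
  exfalso
  have comm_fst : ∀ {x y : G₁ × G₂}, Commute x y → Commute x.1 y.1 :=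
    fun h => congrArg Prod.fst h.eq
  have comm_snd : ∀ {x y : G₁ × G₂}, Commute x y → Commute x.2 y.2 :=
    fun h => congrArg Prod.snd h.eq
  have onto₁ : ∀ l : G₁, ∃ g, l = (τ g).1 * ((α g).1 * (β g).1) := fun l =>
    ⟨(l, 1), (congrArg Prod.fst (hsum (l, 1))).symm⟩
  have onto₂ : ∀ l : G₂, ∃ g, l = (τ g).2 * ((α g).2 * (β g).2) := fun l =>
    ⟨(1, l), (congrArg Prod.snd (hsum (1, l))).symm⟩
  -- Each element of G₁ is a product of coordinates of τ, α and β; the first is central and the last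
  -- commutes with α, so commuting α-coordinates are central.
  have cα₁ : (∀ g h, Commute (α g).1 (α h).1) → ∀ g, (α g).1 ∈ Subgroup.center G₁ := by
    refine fun H g => mem_center_of_forall_commute fun l => ?_
    obtain ⟨l, rfl⟩ := onto₁ l
    exact (comm_fst (hτc _ _)).mul_right ((H _ _).mul_right (comm_fst (hαβ _ _)))
  have cα₂ : (∀ g h, Commute (α g).2 (α h).2) → ∀ g, (α g).2 ∈ Subgroup.center G₂ := by
    refine fun H g => mem_center_of_forall_commute fun l => ?_
    obtain ⟨l, rfl⟩ := onto₂ l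
    exact (comm_snd (hτc _ _)).mul_right ((H _ _).mul_right (comm_snd (hαβ _ _)))
  have cβ₁ : (∀ g h, Commute (β g).1 (β h).1) → ∀ g, (β g).1 ∈ Subgroup.center G₁ := by
    refine fun H g => mem_center_of_forall_commute fun l => ?_
    obtain ⟨l, rfl⟩ := onto₁ l
    exact (comm_fst (hτc _ _)).mul_right ((comm_fst (hαβ _ _)).symm.mul_right (H _ _))
  have cβ₂ : (∀ g h, Commute (β g).2 (β h).2) → ∀ g, (β g).2 ∈ Subgroup.center G₂ := by
    refine fun H g => mem_center_of_forall_commute fun l => ?_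
    obtain ⟨l, rfl⟩ := onto₂ l
    exact (comm_snd (hτc _ _)).mul_right ((comm_snd (hαβ _ _)).symm.mul_right (H _ _))
  have or₁ : (∀ g h, Commute (α g).1 (α h).1) ∨ ∀ g h, Commute (β g).1 (β h).1 := by
    by_contra! H
    obtain ⟨⟨g, h, hgh⟩, g', h', hgh'⟩ := H
    exact (h₁.noCommutingPairs (α g).1 (α h).1 (β g').1 (β h').1 (comm_fst (hαβ _ _))
      (comm_fst (hαβ _ _)) (comm_fst (hαβ _ _)) (comm_fst (hαβ _ _))).elim hgh hgh'
  have or₂ : (∀ g h, Commute (α g).2 (α h).2) ∨ ∀ g h, Commute (β g).2 (β h).2 := by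
    by_contra! H
    obtain ⟨⟨g, h, hgh⟩, g', h', hgh'⟩ := H
    exact (h₂.noCommutingPairs (α g).2 (α h).2 (β g').2 (β h').2 (comm_snd (hαβ _ _))
      (comm_snd (hαβ _ _)) (comm_snd (hαβ _ _)) (comm_snd (hαβ _ _))).elim hgh hgh'
  -- If the same projection is abelian in both coordinates, its image is abelian, already excluded;
  -- the mixed cases are the exponent count.
  rcases or₁ with A | A <;> rcases or₂ with A' | A'
  · exact hα' fun g h => Prod.ext (A g h) (A' g h)
  · exact false_of_projections h₁ h₂ hp hq (α := β) (β := α)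
      (fun g => by rw [← (hαβ g g).eq, hsum]) hτ hβ hα hfβ hfα (cα₁ A) (cβ₂ A')
  · exact false_of_projections h₁ h₂ hp hq hsum hτ hα hβ hfα hfβ (cβ₁ A) (cα₂ A')
  · exact hβ' fun g h => Prod.ext (A g h) (A' g h)

end Product

theorem IsBaumslag.nonempty_zpowers_mulEquiv {G₁ G₂ : Type*} [Group G₁] [Group G₂] {p : ℕ}
    {f : G₁} (h₁ : IsBaumslag p f) (φ : G₂) :
    Nonempty (Subgroup.zpowers (f, φ⁻¹) ≃* Multiplicative ℤ) := by
  have hinj : Function.Injective (zpowersHom _ (f, φ⁻¹)) := by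
    rw [injective_iff_map_eq_one]
    intro n hn
    rw [zpowersHom_apply] at hn
    exact h₁.eq_zero_of_zpow_eq_one (congrArg Prod.fst hn)
  refine ⟨((MonoidHom.ofInjective hinj).trans (MulEquiv.subgroupCongr ?_)).symm⟩
  ext x
  rfl

/-! ### T and its complements -/

section Complement

variable {G₁ G₂ : Type*} [Group G₁] [Group G₂] {p q : ℕ} {f : G₁} {φ : G₂}
  (h₁ : IsBaumslag p f) (h₂ : IsBaumslag q φ)
include h₁ h₂

theorem normal_zpowers : (Subgroup.zpowers (f, φ⁻¹)).Normal := by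
  refine ⟨fun x hx g => ?_⟩
  have hle : Subgroup.zpowers (f, φ⁻¹) ≤ Subgroup.center (G₁ × G₂) := by
    rw [Subgroup.zpowers_le]
    exact mk_mem_center h₁ h₂
  rw [Subgroup.mem_center_iff.1 (hle hx) g, mul_inv_cancel_right]
  exact hx

theorem directlyIndecomposable_zpowers :
    DirectlyIndecomposable (Subgroup.zpowers (f, φ⁻¹)) := by
  obtain ⟨e⟩ := h₁.nonempty_zpowers_mulEquiv φ
  have : Nontrivial (Subgroup.zpowers (f, φ⁻¹)) := e.toEquiv.nontrivial
  exact directlyIndecomposable_of_isCyclic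
    ((h₁.torsionFree.prod h₂.torsionFree).of_injective (Subgroup.subtype_injective _))

theorem exists_isCompl (hpq : p.Coprime q) :
    ∃ S : Subgroup (G₁ × G₂), S.Normal ∧ IsCompl (Subgroup.zpowers (f, φ⁻¹)) S := by
  obtain ⟨χ₁, hχ₁⟩ := h₁.exists_hom
  obtain ⟨χ₂, hχ₂⟩ := h₂.exists_hom
  obtain ⟨u, v, huv⟩ := Nat.isCoprime_iff_coprime.2 hpq
  -- The Bézout relation u p + v q = 1 makes χ(f, φ⁻¹) a generator; the sign of `-v` absorbs the
  -- inverse of φ.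
  let χ : G₁ × G₂ →* Multiplicative ℤ :=
    (χ₁.comp (MonoidHom.fst G₁ G₂)) ^ u * (χ₂.comp (MonoidHom.snd G₁ G₂)) ^ (-v)
  have hχ : χ (f, φ⁻¹) = Multiplicative.ofAdd 1 := by
    simp only [χ, MonoidHom.mul_apply, MonoidHom.zpow_apply, MonoidHom.comp_apply,
      MonoidHom.coe_fst, MonoidHom.coe_snd, map_inv, hχ₁, hχ₂, ← ofAdd_zsmul, ← ofAdd_neg,
      ← ofAdd_add, smul_eq_mul]
    congr 1
    linear_combination huv
  have hχn : ∀ n : ℤ, χ ((f, φ⁻¹) ^ n) = Multiplicative.ofAdd n := fun n => by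
    rw [map_zpow, hχ, ← ofAdd_zsmul, smul_eq_mul, mul_one]
  refine ⟨χ.ker, inferInstance, IsCompl.of_eq ?_ ?_⟩
  · rw [eq_bot_iff]
    rintro _ ⟨⟨n, rfl⟩, hn⟩
    have hn' : n = 0 := (hχn n).symm.trans hn
    simp [hn']
  · rw [eq_top_iff]
    intro g _
    have e : g = (f, φ⁻¹) ^ (χ g).toAdd * (((f, φ⁻¹) ^ (χ g).toAdd)⁻¹ * g) := by group
    rw [e]
    refine Subgroup.mul_mem_sup ⟨_, rfl⟩ ?_
    rw [MonoidHom.mem_ker, map_mul, map_inv, hχn, ofAdd_toAdd, inv_mul_cancel]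

variable {S : Subgroup (G₁ × G₂)} (hS : S.Normal) (h : IsCompl (Subgroup.zpowers (f, φ⁻¹)) S)
include hS h

open scoped commutatorElement in
-- The projections of (a₁, t₁) and (a₂, t₂) to S centralize each other. If one pair commuted, its
-- commutator in D would lie in T; but it has a trivial coordinate, and T meets each factor
-- trivially.
theorem not_noCommutingPairs_of_isCompl : ¬ NoCommutingPairs S := by
  obtain ⟨a₁, s₁, w₁, t₁, r₁, hat₁, -⟩ := h₁.exists_relations
  obtain ⟨a₂, s₂, w₂, t₂, r₂, hat₂, -⟩ := h₂.exists_relations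
  obtain ⟨τ, σ, hsum, -⟩ := exists_projections (normal_zpowers h₁ h₂) hS h
  have key : ∀ x y, Commute (σ x) (σ y) → ∃ n : ℤ, (f, φ⁻¹) ^ n = ⁅x, y⁆ := by
    intro x y hxy
    have e : σ ⁅x, y⁆ = 1 := by
      rw [map_commutatorElement, commutatorElement_eq_one_iff_commute]
      exact hxy
    have e' := hsum ⁅x, y⁆
    rw [e, Subgroup.coe_one, mul_one] at e'
    exact e' ▸ (τ ⁅x, y⁆).2
  intro H
  have hc : ∀ x y, Commute (σ (x, 1)) (σ (1, y)) := fun x y =>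
    Commute.map (Prod.ext (by simp) (by simp) : Commute ((x, 1) : G₁ × G₂) (1, y)) σ
  rcases H (σ (a₁, 1)) (σ (t₁, 1)) (σ (1, a₂)) (σ (1, t₂)) (hc _ _) (hc _ _) (hc _ _) (hc _ _)
    with H | H
  · obtain ⟨n, hn⟩ := key _ _ H
    have hn₂ : φ ^ n = 1 := by simpa [commutatorElement_def] using congrArg Prod.snd hn
    rw [h₂.eq_zero_of_zpow_eq_one hn₂, zpow_zero] at hn
    exact hat₁ (commutatorElement_eq_one_iff_commute.1 (congrArg Prod.fst hn).symm)
  · obtain ⟨n, hn⟩ := key _ _ H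
    have hn₁ : f ^ n = 1 := by simpa [commutatorElement_def] using congrArg Prod.fst hn
    rw [h₁.eq_zero_of_zpow_eq_one hn₁, zpow_zero] at hn
    exact hat₂ (commutatorElement_eq_one_iff_commute.1 (congrArg Prod.snd hn).symm)

theorem directlyIndecomposable_of_isCompl (hp : 1 < p) (hq : 1 < q) :
    DirectlyIndecomposable S := by
  obtain ⟨τ, σ, hsum, -, hσ, hσT, -⟩ := exists_projections (normal_zpowers h₁ h₂) hS h
  have hT : σ (f, φ⁻¹) = 1 := hσT ⟨_, Subgroup.mem_zpowers _⟩
  refine ⟨?_, fun H L hH hL hHL => ?_⟩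
  · by_contra hN
    rw [not_nontrivial_iff_subsingleton] at hN
    exact not_noCommutingPairs_of_isCompl h₁ h₂ hS h fun _ _ _ _ _ _ _ _ =>
      .inl (Subsingleton.elim _ _)
  obtain ⟨α, β, hsum', hα, hβ, -, -⟩ := exists_projections hH hL hHL
  have e := eq_one_or_eq_one_of_projections h₁ h₂ hp hq
    (τ := (Subgroup.subtype _).comp τ) (α := (S.subtype.comp (H.subtype.comp α)).comp σ)
    (β := (S.subtype.comp (L.subtype.comp β)).comp σ)
    (fun g => by
      conv_rhs => rw [← hsum g, ← hsum' (σ g)]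
      rfl)
    (fun g => (τ g).2) (fun g => by simp [hσ, hα]) (fun g => by simp [hσ, hβ])
    (by simp [hT]) (by simp [hT])
    (fun g l => (Subgroup.commute_of_normal_of_disjoint H L hH hL hHL.disjoint _ _
      (α (σ g)).2 (β (σ l)).2).map S.subtype)
  refine e.imp (fun e => ?_) (fun e => ?_)
  · rw [eq_bot_iff]
    intro x hx
    simpa [hσ, hα ⟨x, hx⟩] using e x
  · rw [eq_bot_iff]
    intro x hx
    simpa [hσ, hβ ⟨x, hx⟩] using e x

end Complement

theorem IsBaumslag.isEmpty_mulEquiv {G H : Type*} [Group G] [Group H] {p : ℕ} {f : G}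
    (hG : IsBaumslag p f) (hH : ¬ NoCommutingPairs H) : IsEmpty (H ≃* G) :=
  ⟨fun e => hH (hG.noCommutingPairs.of_injective (φ := e.toMonoidHom) e.injective)⟩

theorem IsBaumslag.isEmpty_mulEquiv_of_forall_commute {G H : Type*} [Group G] [Group H] {p : ℕ}
    {f : G} (hG : IsBaumslag p f) (hH : ∀ x y : H, Commute x y) : IsEmpty (H ≃* G) := by
  obtain ⟨a, s, w, t, -, hat, -⟩ := hG.exists_relations
  refine ⟨fun e => hat ?_⟩
  have := (hH (e.symm a) (e.symm t)).map e.toMonoidHom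
  simpa using this

end BaumslagExample

open BaumslagExample in
theorem BaumslagExample.decomposition {G₁ G₂ : Type*} [Group G₁] [Group G₂] {p q : ℕ} {f : G₁}
    {φ : G₂} (h₁ : IsBaumslag p f) (h₂ : IsBaumslag q φ) (hp : 1 < p) (hq : 1 < q)
    (hpq : p.Coprime q) :
    ∃ T : Subgroup (G₁ × G₂),
      T = Subgroup.zpowers (f, φ⁻¹) ∧ T.Normal ∧ Nonempty (T ≃* Multiplicative ℤ) ∧
      DirectlyIndecomposable T ∧ IsEmpty (T ≃* G₁) ∧ IsEmpty (T ≃* G₂) ∧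
      (∃ S : Subgroup (G₁ × G₂), S.Normal ∧ IsCompl T S) ∧
      ∀ S : Subgroup (G₁ × G₂), S.Normal → IsCompl T S →
        Nonempty ((G₁ × G₂) ≃* Multiplicative ℤ × S) ∧ DirectlyIndecomposable S ∧
        IsEmpty (S ≃* G₁) ∧ IsEmpty (S ≃* G₂) := by
  refine ⟨_, rfl, normal_zpowers h₁ h₂, h₁.nonempty_zpowers_mulEquiv φ,
    directlyIndecomposable_zpowers h₁ h₂,
    h₁.isEmpty_mulEquiv_of_forall_commute fun x y => mul_comm' x y,
    h₂.isEmpty_mulEquiv_of_forall_commute fun x y => mul_comm' x y,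
    exists_isCompl h₁ h₂ hpq, fun S hS h => ?_⟩
  have hN := not_noCommutingPairs_of_isCompl h₁ h₂ hS h
  obtain ⟨e⟩ := h₁.nonempty_zpowers_mulEquiv φ
  exact ⟨⟨(prodMulEquivOfIsCompl (normal_zpowers h₁ h₂) hS h).symm.trans
    (e.prodCongr (MulEquiv.refl S))⟩, directlyIndecomposable_of_isCompl h₁ h₂ hS h hp hq,
    h₁.isEmpty_mulEquiv hN, h₂.isEmpty_mulEquiv hN⟩

theorem mainTheorem10 :
    -- the rational closure of `K` exists
    (∃ (R : Type) (_ : Group R) (ι : BaumslagExample.K →* R),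
      BaumslagExample.IsRationalClosure ι) ∧
    (∀ (R : Type*) [Group R] (ι : BaumslagExample.K →* R), BaumslagExample.IsRationalClosure ι →
      -- each `G_p` is finitely generated, torsion-free, nilpotent and directly indecomposable
      (∀ p : ℕ, 1 < p →
        Group.FG (BaumslagExample.baumslagGroup ι p) ∧
        BaumslagExample.TorsionFree (BaumslagExample.baumslagGroup ι p) ∧
        Group.IsNilpotent (BaumslagExample.baumslagGroup ι p) ∧
        BaumslagExample.DirectlyIndecomposable (BaumslagExample.baumslagGroup ι p)) ∧
      -- the element `(f, φ⁻¹)` generates an infinite cyclic direct factor `T` of `G_p × G_q`, and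
      -- every complement `S` of `T` is indecomposable and isomorphic to neither `G_p` nor `G_q`
      (∀ p q : ℕ, 1 < p → 1 < q → Nat.Coprime p q →
        ∃ T : Subgroup (BaumslagExample.baumslagGroup ι p × BaumslagExample.baumslagGroup ι q),
          T = Subgroup.zpowers
            (BaumslagExample.baumslagGroup.f ι p, (BaumslagExample.baumslagGroup.f ι q)⁻¹) ∧
          T.Normal ∧
          Nonempty (T ≃* Multiplicative ℤ) ∧
          BaumslagExample.DirectlyIndecomposable T ∧
          IsEmpty (T ≃* BaumslagExample.baumslagGroup ι p) ∧
          IsEmpty (T ≃* BaumslagExample.baumslagGroup ι q) ∧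
          (∃ S : Subgroup (BaumslagExample.baumslagGroup ι p × BaumslagExample.baumslagGroup ι q),
            S.Normal ∧ IsCompl T S) ∧
          ∀ S : Subgroup (BaumslagExample.baumslagGroup ι p × BaumslagExample.baumslagGroup ι q),
            S.Normal → IsCompl T S →
              Nonempty ((BaumslagExample.baumslagGroup ι p × BaumslagExample.baumslagGroup ι q)
                ≃* Multiplicative ℤ × S) ∧
              BaumslagExample.DirectlyIndecomposable S ∧
              IsEmpty (S ≃* BaumslagExample.baumslagGroup ι p) ∧
              IsEmpty (S ≃* BaumslagExample.baumslagGroup ι q))) ∧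
    -- direct decompositions of finitely generated torsion-free nilpotent groups into
    -- indecomposable factors are not unique, even up to isomorphism
    (∃ (D G₁ G₂ H₁ H₂ : Type) (_ : Group D) (_ : Group G₁) (_ : Group G₂) (_ : Group H₁)
        (_ : Group H₂),
      Group.FG D ∧ BaumslagExample.TorsionFree D ∧ Group.IsNilpotent D ∧
      BaumslagExample.DirectlyIndecomposable G₁ ∧ BaumslagExample.DirectlyIndecomposable G₂ ∧
      BaumslagExample.DirectlyIndecomposable H₁ ∧ BaumslagExample.DirectlyIndecomposable H₂ ∧
      Nonempty (D ≃* G₁ × G₂) ∧ Nonempty (D ≃* H₁ × H₂) ∧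
      IsEmpty (G₁ ≃* H₁) ∧ IsEmpty (G₁ ≃* H₂) ∧ IsEmpty (G₂ ≃* H₁) ∧ IsEmpty (G₂ ≃* H₂)) := by
  refine ⟨⟨_, _, _, BaumslagExample.K.isRationalClosure_toRationalModel⟩,
    fun R _ ι hι => ⟨fun p hp => ?_, fun p q hp hq hpq => ?_⟩, ?_⟩
  · have := hι.nilpotent
    exact ⟨hι.fg_baumslagGroup (zero_lt_one.trans hp),
      hι.torsionFree.of_injective (Subgroup.subtype_injective _), inferInstance,
      (hι.isBaumslag (zero_lt_one.trans hp)).directlyIndecomposable hp⟩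
  · exact BaumslagExample.decomposition (hι.isBaumslag (zero_lt_one.trans hp))
      (hι.isBaumslag (zero_lt_one.trans hq)) hp hq hpq
  · have hι := BaumslagExample.K.isRationalClosure_toRationalModel
    -- The coprime pair p = 2, q = 3 in the rational coordinate group supplies the example.
    have h₁ := hι.isBaumslag two_pos
    have h₂ := hι.isBaumslag three_pos
    obtain ⟨T, -, -, ⟨e⟩, hT, hT₁, hT₂, ⟨S, hS, h⟩, H⟩ :=
      BaumslagExample.decomposition h₁ h₂ (by norm_num) (by norm_num) (by norm_num)
    obtain ⟨⟨e'⟩, hS', hS₁, hS₂⟩ := H S hS h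
    have := hι.fg_baumslagGroup two_pos
    have := hι.fg_baumslagGroup three_pos
    have := hι.nilpotent
    exact ⟨_, _, _, T, S, inferInstance, inferInstance, inferInstance, inferInstance,
      inferInstance, inferInstance, h₁.torsionFree.prod h₂.torsionFree, inferInstance,
      h₁.directlyIndecomposable (by norm_num), h₂.directlyIndecomposable (by norm_num), hT, hS',
      ⟨MulEquiv.refl _⟩, ⟨e'.trans (e.symm.prodCongr (MulEquiv.refl S))⟩,
      ⟨fun i => hT₁.false i.symm⟩, ⟨fun i => hS₁.false i.symm⟩,
      ⟨fun i => hT₂.false i.symm⟩, ⟨fun i => hS₂.false i.symm⟩⟩
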